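/- Let $r,s,n$ be positive integers with $s\mid r$, and put $\zeta_r=e^{2\pi i/r}$. For $1\le i<j\le n$ and $0\le k<r$ let $\sigma_{ij}^{k/r}\in \mathrm{GL}_n(\mathbb C)$ be the reflection $$(a_1,\dots,a_i,\dots,a_j,\dots,a_n)\mapsto(a_1,\dots,\zeta_r^{-k}a_j,\dots,\zeta_r^{k}a_i,\dots,a_n),$$ and for $1\le i\le n$ and $0<k<r/s$ let $\tau_i^{sk/r}\in \mathrm{GL}_n(\mathbb C)$ be the reflection that multiplies the $i$-th coordinate by $\zeta_r^{sk}$. Let $R$ be the set of all these reflections and let $G(r,s,n)\subset\mathrm{GL}_n(\mathbb C)$ be the group generated by $R$; in particular $G(r,s,1)=\mu_{r/s}$ is the group of $(r/s)$-th roots of unity. For $\omega\in G(r,s,n)$ let $\pi(\omega)\in S_n$ be the permutation matrix obtained by replacing every nonzero entry of $\omega$ by $1$, let $\phi(\omega)\in\mu_{r/s}=G(r,s,1)$ be the product of the nonzero entries of $\omega$, and let $\delta(\omega)=1$ if $\phi(\omega)=1$ and $\delta(\omega)=0$ otherwise. The factorization series of an element $\omega$ of $G(r,s,n)$ is the formal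 power series $$f^\omega(x)=\sum_{m\ge0}f_m^\omega\frac{x^m}{m!},\qquad f_m^\omega=\#\{(\rho_1,\dots,\rho_m)\in R^m : \rho_m\cdots\rho_1=\omega\};$$ the series $f^{\phi(\omega)}(x)$ is the factorization series of $\phi(\omega)$ as an element of $G(r,s,1)$. If $\omega\in G(r,s,n)$ is such that $\pi(\omega)$ is a long cycle (its cycle type is $(n)$), then $$f^\omega(x)=\frac{1}{n!\,r^{n-1}}\,f^{\phi(\omega)}(nx)\,\bigl(e^{xrn/2}-e^{-xrn/2}\bigr)^{n-1},$$ where $$f^{\phi(\omega)}(x)=\frac{1}{r/s}\bigl(e^{(r/s-1)x}-e^{-x}\bigr)+\delta(\omega)e^{-x}.$$ If moreover $s=1$ and $\phi(\omega)\ne1$ (which includes the Coxeter elements of $G(r,1,n)$ for $r\ge2$), this gives the Chapuy–Stump formula $$f^\omega(x)=\frac{1}{|G(r,1,n)|}\bigl(e^{x|R|/n}-e^{-x|R^*|/n}\bigr)^{n},$$ where $R^*$ is the set of reflecting hyperplanes, i.e. of fixed spaces of the elements of $R$. -/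

import Mathlib

noncomputable section

namespace ReflectionFactorization

/-- The primitive `r`-th root of unity `ζ_r = e^{2πi/r}`. -/
def zeta (r : ℕ) : ℂ := Complex.exp (2 * Real.pi * Complex.I / r)

theorem zeta_ne_zero (r : ℕ) : zeta r ≠ 0 := Complex.exp_ne_zero _

/-- The matrix of `σ_{ij}^{k/r}` (for `i ≠ j`), that is of the map
`(a_1, …, a_i, …, a_j, …, a_n) ↦ (a_1, …, ζ_r^{-k} a_j, …, ζ_r^k a_i, …, a_n)`. -/
def sigmaMatrix (r : ℕ) {n : ℕ} (i j : Fin n) (k : ℕ) : Matrix (Fin n) (Fin n) ℂ :=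
  Matrix.of fun a b =>
    if a = i then (if b = j then (zeta r ^ k)⁻¹ else 0)
    else if a = j then (if b = i then zeta r ^ k else 0)
    else if b = a then 1 else 0

/-- The matrix of `τ_i^{k/r}`, that is of the map multiplying the `i`-th coordinate
by `ζ_r^k`. -/
def tauMatrix (r : ℕ) {n : ℕ} (i : Fin n) (k : ℕ) : Matrix (Fin n) (Fin n) ℂ :=
  Matrix.diagonal fun a => if a = i then zeta r ^ k else 1

theorem sigmaMatrix_mulVec (r : ℕ) {n : ℕ} (i j : Fin n) (k : ℕ) (v : Fin n → ℂ) :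
    (sigmaMatrix r i j k).mulVec v = fun a =>
      if a = i then (zeta r ^ k)⁻¹ * v j else if a = j then zeta r ^ k * v i else v a := by
  funext a
  simp only [Matrix.mulVec, dotProduct, sigmaMatrix, Matrix.of_apply]
  split_ifs <;> simp

theorem sigmaMatrix_mul_self (r : ℕ) {n : ℕ} {i j : Fin n} (h : i ≠ j) (k : ℕ) :
    sigmaMatrix r i j k * sigmaMatrix r i j k = 1 := by
  have hz : zeta r ^ k ≠ 0 := pow_ne_zero _ (zeta_ne_zero r)
  apply Matrix.toLin'.injective
  refine LinearMap.ext fun v => ?_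
  simp only [Matrix.toLin'_apply, ← Matrix.mulVec_mulVec, sigmaMatrix_mulVec, Matrix.one_mulVec]
  funext a
  by_cases ha : a = i
  · subst ha
    simp [h.symm, hz]
  · by_cases hb : a = j
    · subst hb
      simp [ha, hz]
    · simp [ha, hb]

theorem tauMatrix_mul_inv (r : ℕ) {n : ℕ} (i : Fin n) (k : ℕ) :
    tauMatrix r i k * Matrix.diagonal (fun a => if a = i then (zeta r ^ k)⁻¹ else 1) = 1 := by
  have hz : zeta r ^ k ≠ 0 := pow_ne_zero _ (zeta_ne_zero r)
  rw [tauMatrix, Matrix.diagonal_mul_diagonal, ← Matrix.diagonal_one]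
  congr 1
  funext a
  split_ifs <;> simp [hz]

/-- The reflection `σ_{ij}^{k/r}` as an element of `GL_n(ℂ)`. -/
def sigma (r : ℕ) {n : ℕ} (i j : Fin n) (h : i < j) (k : ℕ) : GL (Fin n) ℂ where
  val := sigmaMatrix r i j k
  inv := sigmaMatrix r i j k
  val_inv := sigmaMatrix_mul_self r h.ne k
  inv_val := sigmaMatrix_mul_self r h.ne k

/-- The element `τ_i^{k/r}` of `GL_n(ℂ)`. -/
def tau (r : ℕ) {n : ℕ} (i : Fin n) (k : ℕ) : GL (Fin n) ℂ where
  val := tauMatrix r i k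
  inv := Matrix.diagonal fun a => if a = i then (zeta r ^ k)⁻¹ else 1
  val_inv := tauMatrix_mul_inv r i k
  inv_val := mul_eq_one_comm.mp (tauMatrix_mul_inv r i k)

/-- The set `R` of reflections of `G(r,s,n)`: all `σ_{ij}^{k/r}` with `i < j` and `0 ≤ k < r`,
and all `τ_i^{sk/r}` with `0 < k < r/s`. -/
def reflections (r s n : ℕ) : Set (GL (Fin n) ℂ) :=
  {ρ | ∃ (i j : Fin n) (h : i < j) (k : ℕ), k < r ∧ ρ = sigma r i j h k} ∪
  {ρ | ∃ (i : Fin n) (k : ℕ), 0 < k ∧ k < r / s ∧ ρ = tau r i (s * k)}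

/-- The complex reflection group `G(r,s,n)`, generated by its set `R` of reflections. -/
def reflectionGroup (r s n : ℕ) : Subgroup (GL (Fin n) ℂ) :=
  Subgroup.closure (reflections r s n)

/-- The reflecting hyperplanes of `G(r,s,n)`: the fixed spaces of its reflections. -/
def reflectingHyperplanes (r s n : ℕ) : Set (Set (Fin n → ℂ)) :=
  {H | ∃ ρ ∈ reflections r s n, H = {v | ρ.1.mulVec v = v}}

/-- `π`: replace every nonzero entry of a matrix by `1`. On `G(r,s,n)` the value is a
permutation matrix. -/
def piMatrix {n : ℕ} (ω : GL (Fin n) ℂ) : Matrix (Fin n) (Fin n) ℂ :=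
  Matrix.of fun a b => if ω.1 a b = 0 then 0 else 1

/-- `M` is the matrix of a long cycle of `S_n`, i.e. of a permutation `c` of the standard basis
vectors (`v_b ↦ v_{c b}`) whose cycle type is `(n)`. -/
def IsLongCycle {n : ℕ} (M : Matrix (Fin n) (Fin n) ℂ) : Prop :=
  ∃ c : Equiv.Perm (Fin n), c.IsCycleOn Set.univ ∧
    M = Matrix.of fun a b => if a = c b then 1 else 0

/-- `φ`: the product of all nonzero entries of a matrix. -/
def phi {n : ℕ} (ω : GL (Fin n) ℂ) : ℂˣ :=
  ∏ a, ∏ b, if h : ω.1 a b = 0 then 1 else Units.mk0 (ω.1 a b) h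

/-- The identification of scalars `κ ∈ ℂˣ` with `GL_1(ℂ)`; it identifies `μ_{r/s}` with
`G(r,s,1)`. -/
def toGLOne (κ : ℂˣ) : GL (Fin 1) ℂ :=
  Units.map (Matrix.scalar (Fin 1) : ℂ →+* Matrix (Fin 1) (Fin 1) ℂ).toMonoidHom κ

/-- `δ(ω) = 1` if `φ(ω) = 1`, and `δ(ω) = 0` otherwise. -/
def delta {n : ℕ} (ω : GL (Fin n) ℂ) : ℚ :=
  open Classical in if phi ω = 1 then 1 else 0

/-- `F^ω_m`: the `m`-tuples of reflections of `G(r,s,n)` with `ρ_m ⋯ ρ_1 = ω`. -/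
def factorizations (r s : ℕ) {n : ℕ} (ω : GL (Fin n) ℂ) (m : ℕ) :
    Set (Fin m → GL (Fin n) ℂ) :=
  {ρ | (∀ t, ρ t ∈ reflections r s n) ∧ (List.ofFn ρ).reverse.prod = ω}

/-- `f^ω(x) = ∑ₘ f^ω_m x^m / m!` with `f^ω_m = |F^ω_m|`, for `ω ∈ G(r,s,n)`. -/
def factorizationSeries (r s : ℕ) {n : ℕ} (ω : GL (Fin n) ℂ) : PowerSeries ℚ :=
  PowerSeries.mk fun m => ((factorizations r s ω m).ncard : ℚ) / (m.factorial : ℚ)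

/-- The formal power series `e^{ax}`. -/
def expSeries (a : ℚ) : PowerSeries ℚ := PowerSeries.rescale a (PowerSeries.exp ℚ)

/-- The set of reflections is finite, so that all sets counted here are finite. -/
theorem reflections_finite (r s n : ℕ) : (reflections r s n).Finite := by
  refine Set.Finite.union ?_ ?_
  · refine (Set.finite_range (fun p : {q : Fin n × Fin n // q.1 < q.2} × Fin r =>
      sigma r p.1.1.1 p.1.1.2 p.1.2 p.2)).subset ?_
    rintro ρ ⟨i, j, h, k, hk, rfl⟩
    exact ⟨(⟨(i, j), h⟩, ⟨k, hk⟩), rfl⟩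
  · refine (Set.finite_range (fun p : Fin n × Fin (r / s) =>
      tau r p.1 (s * (p.2 : ℕ)))).subset ?_
    rintro ρ ⟨i, k, -, hk, rfl⟩
    exact ⟨(i, ⟨k, hk⟩), rfl⟩

theorem factorizations_finite (r s : ℕ) {n : ℕ} (ω : GL (Fin n) ℂ) (m : ℕ) :
    (factorizations r s ω m).Finite :=
  (Set.Finite.pi' fun _ : Fin m => reflections_finite r s n).subset fun _ h => h.1

end ReflectionFactorization

end

noncomputable section
namespace ReflectionFactorization
open Polynomial Matrix

/-! ### Transpositions acting on `det (1 - X P_c) / (1 - X)` -/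

section Determinants

variable {ι : Type*} [Fintype ι] [DecidableEq ι]

/-! Factorizations are counted by elementary linear algebra in place of character tables. For `c` in
`S_n` let `q_c = det (1 - X P_c) / (1 - X)`. Up to sign its coefficients are the characters of the
exterior powers of the standard representation. Summing `q` over all `(i j) c` applies a multiple of
the identity plus a multiple of `X d/dX` (`sum_cyclePoly_swap_mul`), so the `k`-th coefficient is an
eigenfunction with eigenvalue `n (n - 1 - 2k) / 2`. Moreover `q_c(1)` is `n` on long cycles and `0`
elsewhere, so the coefficients together detect long cycles.

In a monomial group with entries in `A` and weights (products of entries) in `B`, a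
transposition-type reflection changes only the permutation and a diagonal one only the weight. Hence
a coefficient of `q` times an eigenfunction of the weight is an eigenfunction for multiplication by
all reflections. The indicator of one weight is a combination of just two of the latter, with
eigenvalues `|B| - 1` and `-1`.

Elements over long cycles with equal weight are conjugate under all monomial matrices, which
preserve the reflections, so they have equally many factorizations; dividing the count for the whole
class by its size gives the count for `ω` (`numFactorizations_eq`). The binomial theorem sums the
exponentials. The same formula in rank one gives the series of `φ(ω)`. -/

theorem derivative_det_eq_sum_updateRow (A : Matrix ι ι ℚ[X]) :
    derivative A.det = ∑ i, (A.updateRow i fun j => derivative (A i j)).det := by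
  have h : ∀ B : Matrix ι ι ℚ[X], B.det =
      ∑ σ : Equiv.Perm ι, C ((Equiv.Perm.sign σ : ℤ) : ℚ) * ∏ i, B i (σ i) := by
    intro B
    rw [← det_transpose, det_apply']
    simp
  simp only [h, Polynomial.derivative_sum]
  rw [Finset.sum_comm]
  refine Finset.sum_congr rfl fun σ _ => ?_
  rw [derivative_C_mul, derivative_prod_finset, Finset.mul_sum]
  refine Finset.sum_congr rfl fun i _ => ?_
  rw [← Finset.prod_erase_mul _ _ (Finset.mem_univ i), updateRow_self]
  congr 2
  refine Finset.prod_congr rfl fun k hk => ?_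
  rw [updateRow_ne (Finset.ne_of_mem_erase hk)]

/-- The matrix `1 - X P_c`, where `P_c` is the permutation matrix of `c`. -/
def oneSubXPerm (c : Equiv.Perm ι) : Matrix ι ι ℚ[X] :=
  of fun a b => (if a = b then 1 else 0) - (if a = c b then X else 0)

/-- The quotient of `det (1 - X P_c)` by `1 - X`, written in terms of the adjugate. -/
def cyclePoly (c : Equiv.Perm ι) : ℚ[X] :=
  C (1 / (Fintype.card ι : ℚ)) * ∑ b, ∑ a, (oneSubXPerm c).adjugate a b

theorem sum_oneSubXPerm_col (c : Equiv.Perm ι) (b : ι) : ∑ a, oneSubXPerm c a b = 1 - X := by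
  simp [oneSubXPerm]

/-- The columns of `1 - X P_c` all sum to `1 - X`, so the all-ones row vector is a left eigenvector;
apply it to `A * adj A = det A`. -/
theorem one_sub_X_mul_sum_adjugate (c : Equiv.Perm ι) (b : ι) :
    (1 - X) * ∑ a, (oneSubXPerm c).adjugate a b = (oneSubXPerm c).det := by
  have h : ∑ a, (oneSubXPerm c * (oneSubXPerm c).adjugate) a b = (oneSubXPerm c).det := by
    simp [mul_adjugate, Matrix.smul_apply, Matrix.one_apply]
  rw [← h]
  simp only [Matrix.mul_apply]
  rw [Finset.sum_comm, Finset.mul_sum]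
  refine Finset.sum_congr rfl fun j _ => ?_
  rw [← Finset.sum_mul, sum_oneSubXPerm_col]

theorem card_mul_cyclePoly [Nonempty ι] (c : Equiv.Perm ι) :
    (Fintype.card ι : ℚ[X]) * cyclePoly c = ∑ b, ∑ a, (oneSubXPerm c).adjugate a b := by
  have : (Fintype.card ι : ℚ) ≠ 0 := by simp
  rw [cyclePoly, ← mul_assoc, ← Polynomial.C_eq_natCast, ← C_mul, mul_one_div_cancel this, C_1, one_mul]

theorem one_sub_X_mul_cyclePoly [Nonempty ι] (c : Equiv.Perm ι) :
    (1 - X) * cyclePoly c = (oneSubXPerm c).det := by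
  have h0 : (Fintype.card ι : ℚ[X]) ≠ 0 := by simp
  apply mul_left_cancel₀ h0
  rw [mul_left_comm, card_mul_cyclePoly, Finset.mul_sum]
  simp [one_sub_X_mul_sum_adjugate]

theorem one_sub_X_ne_zero : (1 - X : ℚ[X]) ≠ 0 := by
  intro h
  simpa using congrArg (eval 0) h

theorem cyclePoly_one [Nonempty ι] : cyclePoly (1 : Equiv.Perm ι) = (1 - X) ^ (Fintype.card ι - 1) := by
  apply mul_left_cancel₀ one_sub_X_ne_zero
  rw [one_sub_X_mul_cyclePoly, ← pow_succ', Nat.sub_add_cancel Fintype.card_pos]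
  have : oneSubXPerm (1 : Equiv.Perm ι) = diagonal fun _ => 1 - X := by
    ext1 a b
    by_cases h : a = b <;> simp [oneSubXPerm, h]
  rw [this, det_diagonal]
  simp

theorem det_updateRow_pi_single (A : Matrix ι ι ℚ[X]) (i j : ι) :
    (A.updateRow i (Pi.single j 1)).det = A.adjugate j i := (adjugate_apply A j i).symm

/-- Applying `X d/dX` to row `i` of `1 - X P_c` gives that row minus `e_i`, hence `det` minus a
diagonal cofactor. -/
theorem X_mul_derivative_det (c : Equiv.Perm ι) :
    X * derivative (oneSubXPerm c).det =
      (Fintype.card ι : ℚ[X]) * (oneSubXPerm c).det - (oneSubXPerm c).adjugate.trace := by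
  rw [derivative_det_eq_sum_updateRow, Finset.mul_sum, Matrix.trace]
  have : ∀ i, X * ((oneSubXPerm c).updateRow i fun j => derivative (oneSubXPerm c i j)).det =
      (oneSubXPerm c).det - (oneSubXPerm c).adjugate.diag i := by
    intro i
    rw [Matrix.diag_apply, ← det_updateRow_pi_single, ← det_updateRow_smul, eq_sub_iff_add_eq,
      ← det_updateRow_add]
    conv_rhs => rw [← updateRow_eq_self (oneSubXPerm c) i]
    congr 2
    ext1 j
    simp only [oneSubXPerm, of_apply, Pi.add_apply, Pi.smul_apply, smul_eq_mul, Pi.single_apply,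
      derivative_sub, eq_comm (a := j)]
    split_ifs <;> simp
    ring
  simp [this]

/-- After its rows `i` and `j` are exchanged, the new matrix is the old one with `e_j - e_i` added
to row `i` and the opposite vector to row `j`. Expand in these two rows: the term using both
increments vanishes, as they are proportional. -/
theorem det_oneSubXPerm_swap_mul (c : Equiv.Perm ι) {i j : ι} (h : i ≠ j) :
    (oneSubXPerm (Equiv.swap i j * c)).det = - (oneSubXPerm c).det +
      (oneSubXPerm c).adjugate i i + (oneSubXPerm c).adjugate j j
      - (oneSubXPerm c).adjugate i j - (oneSubXPerm c).adjugate j i := by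
  set A := oneSubXPerm c with hA
  have hrow : (oneSubXPerm (Equiv.swap i j * c)).submatrix (Equiv.swap i j) id =
      (A.updateRow i (A i + (Pi.single j 1 - Pi.single i 1))).updateRow j
        (A j + (Pi.single i 1 - Pi.single j 1)) := by
    ext1 a b
    have hc : Equiv.swap i j a = Equiv.swap i j (c b) ↔ a = c b := (Equiv.swap i j).apply_eq_iff_eq
    simp only [submatrix_apply, oneSubXPerm, of_apply, Equiv.Perm.mul_apply, hc, id]
    rcases eq_or_ne a j with rfl | haj
    · rw [updateRow_self]
      simp only [hA, oneSubXPerm, of_apply, Pi.add_apply, Pi.sub_apply, Pi.single_apply,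
        Equiv.swap_apply_right, eq_comm (a := b)]
      ring
    · rw [updateRow_ne haj]
      rcases eq_or_ne a i with rfl | hai
      · rw [updateRow_self]
        simp only [hA, oneSubXPerm, of_apply, Pi.add_apply, Pi.sub_apply, Pi.single_apply,
          Equiv.swap_apply_left, eq_comm (a := b)]
        ring
      · rw [updateRow_ne hai, Equiv.swap_apply_of_ne_of_ne hai haj]
        simp [hA, oneSubXPerm]
  have hsign := det_permute (Equiv.swap i j) (oneSubXPerm (Equiv.swap i j * c))
  have hsub : ∀ (B : Matrix ι ι ℚ[X]) (k : ι) (u v : ι → ℚ[X]),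
      (B.updateRow k (u - v)).det = (B.updateRow k u).det - (B.updateRow k v).det := by
    intro B k u v
    rw [eq_sub_iff_add_eq, ← det_updateRow_add, sub_add_cancel]
  have h1 : (A.updateRow i (A i + (Pi.single j 1 - Pi.single i 1))).det =
      A.det + (A.adjugate j i - A.adjugate i i) := by
    rw [det_updateRow_add, hsub, updateRow_eq_self, det_updateRow_pi_single,
      det_updateRow_pi_single]
  have h2 : ((A.updateRow i (A i + (Pi.single j 1 - Pi.single i 1))).updateRow j
      (Pi.single i 1 - Pi.single j 1)).det = A.adjugate i j - A.adjugate j j := by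
    rw [updateRow_comm _ h, det_updateRow_add]
    have hz : ((A.updateRow j (Pi.single i 1 - Pi.single j 1)).updateRow i
        (Pi.single j 1 - Pi.single i 1)).det = 0 := by
      rw [← neg_sub (Pi.single i 1 : ι → ℚ[X]), ← neg_one_smul ℚ[X], det_updateRow_smul]
      rw [det_zero_of_row_eq h (by rw [updateRow_self, updateRow_ne h.symm, updateRow_self]),
        mul_zero]
    have hi : (A.updateRow j (Pi.single i 1 - Pi.single j 1)).updateRow i (A i) =
        A.updateRow j (Pi.single i 1 - Pi.single j 1) := by
      conv_rhs => rw [← updateRow_eq_self (A.updateRow j (Pi.single i 1 - Pi.single j 1)) i,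
        updateRow_ne h]
    rw [hz, add_zero, hi, hsub, det_updateRow_pi_single, det_updateRow_pi_single]
  have h3 : ((A.updateRow i (A i + (Pi.single j 1 - Pi.single i 1))).updateRow j (A j)) =
      A.updateRow i (A i + (Pi.single j 1 - Pi.single i 1)) := by
    conv_rhs => rw [← updateRow_eq_self
      (A.updateRow i (A i + (Pi.single j 1 - Pi.single i 1))) j, updateRow_ne h.symm]
  rw [hrow, det_updateRow_add, h2, h3, h1, Equiv.Perm.sign_swap h] at hsign
  simp only [Units.val_neg, Units.val_one, Int.cast_neg, Int.cast_one] at hsign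
  linear_combination hsign

/-- The sum over pairs involves only the determinant, trace and total sum of the adjugate. The trace
is eliminated through the derivative, the total sum through `card_mul_cyclePoly`. The resulting
operator is diagonal on monomials. -/
theorem sum_cyclePoly_swap_mul [Nonempty ι] (c : Equiv.Perm ι) :
    ∑ p : ι × ι with p.1 ≠ p.2, cyclePoly (Equiv.swap p.1 p.2 * c) =
      (Fintype.card ι * (Fintype.card ι - 1) : ℚ[X]) * cyclePoly c
        - 2 * (Fintype.card ι : ℚ[X]) * X * derivative (cyclePoly c) := by
  have hD := one_sub_X_mul_cyclePoly c
  have hE := card_mul_cyclePoly c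
  have hJ := X_mul_derivative_det c
  set n : ℚ[X] := (Fintype.card ι : ℚ[X]) with hn
  set A := oneSubXPerm c with hA
  have hsum : ∑ p : ι × ι with p.1 ≠ p.2, (oneSubXPerm (Equiv.swap p.1 p.2 * c)).det =
      - (n * (n - 1)) * A.det + 2 * n * A.adjugate.trace - 2 * ∑ b, ∑ a, A.adjugate a b := by
    have h1 : ∀ p ∈ ({p : ι × ι | p.1 ≠ p.2} : Finset (ι × ι)),
        (oneSubXPerm (Equiv.swap p.1 p.2 * c)).det = - A.det +
          A.adjugate p.1 p.1 + A.adjugate p.2 p.2 - A.adjugate p.1 p.2 - A.adjugate p.2 p.1 := by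
      intro p hp
      exact det_oneSubXPerm_swap_mul c (by simpa using hp)
    rw [Finset.sum_congr rfl h1, Finset.sum_filter]
    -- At `i = j` the expression equals `-det A`, so adding `det A` there extends the sum to all
    -- pairs.
    have h2 : ∀ p : ι × ι, (if p.1 ≠ p.2 then - A.det +
          A.adjugate p.1 p.1 + A.adjugate p.2 p.2 - A.adjugate p.1 p.2 - A.adjugate p.2 p.1
          else 0) = (- A.det +
          A.adjugate p.1 p.1 + A.adjugate p.2 p.2 - A.adjugate p.1 p.2 - A.adjugate p.2 p.1) +
          if p.1 = p.2 then A.det else 0 := by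
      rintro ⟨a, b⟩
      by_cases h : a = b
      · subst h; simp
      · simp [h]
    rw [Finset.sum_congr rfl fun p _ => h2 p, Fintype.sum_prod_type]
    simp only [Finset.sum_add_distrib, Finset.sum_sub_distrib, Finset.sum_const,
      Finset.sum_ite_eq, Finset.mem_univ, if_true, Finset.card_univ, nsmul_eq_mul, ← hn,
      Matrix.trace, Matrix.diag_apply, ← Finset.mul_sum]
    rw [Finset.sum_comm (f := fun a b => A.adjugate a b)]
    ring
  apply mul_left_cancel₀ one_sub_X_ne_zero
  rw [Finset.mul_sum]
  simp only [one_sub_X_mul_cyclePoly]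
  rw [hsum, ← hE]
  rw [← hD, derivative_mul] at hJ
  simp only [derivative_sub, derivative_one, derivative_X] at hJ
  rw [← hD]
  linear_combination 2 * n * hJ

/-- Only `1` and `c` contribute to the Leibniz sum: a contributing `σ` sends each `a` to `a` or `c
a`, and once it follows `c` at one point, injectivity forces it to do so along the whole orbit. -/
theorem det_oneSubXPerm_of_isCycleOn [Nontrivial ι] (c : Equiv.Perm ι)
    (hc : c.IsCycleOn Set.univ) : (oneSubXPerm c).det = 1 - X ^ Fintype.card ι := by
  have hne : ∀ a, c a ≠ a := fun a => hc.apply_ne Set.nontrivial_univ (Set.mem_univ a)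
  have hc1 : (1 : Equiv.Perm ι) ≠ c := by
    intro h
    obtain ⟨a⟩ : Nonempty ι := inferInstance
    exact hne a (by rw [← h]; rfl)
  have hcyc : c.IsCycle := by
    obtain ⟨a⟩ : Nonempty ι := inferInstance
    exact ⟨a, hne a, fun b _ => hc.2 (Set.mem_univ a) (Set.mem_univ b)⟩
  have hsupp : c.support = Finset.univ := by ext a; simp [hne a]
  rw [det_apply', ← Finset.sum_subset (Finset.subset_univ {1, c})]
  · rw [Finset.sum_pair hc1, hcyc.sign, hsupp, Finset.card_univ]
    have h1 : ∀ a, oneSubXPerm c ((1 : Equiv.Perm ι) a) a = 1 := by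
      intro a
      simp [oneSubXPerm, (hne a).symm]
    have h2 : ∀ a, oneSubXPerm c (c a) a = -X := by
      intro a
      simp [oneSubXPerm, hne a]
    simp only [h1, h2]
    simp only [Finset.prod_const, Finset.card_univ, Equiv.Perm.sign_one, Units.val_one, Int.cast_one,
      one_pow, mul_one, Units.val_neg, Units.val_pow_eq_pow_val, Int.cast_neg, Int.cast_pow]
    rw [neg_pow (X : ℚ[X]), neg_mul, ← mul_assoc, ← mul_pow]
    simp [sub_eq_add_neg]
  · intro σ _ hσ
    rw [Finset.mem_insert, Finset.mem_singleton, not_or] at hσ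
    by_contra hprod
    have hor : ∀ a, σ a = a ∨ σ a = c a := by
      intro a
      have := Finset.prod_ne_zero_iff.mp (right_ne_zero_of_mul hprod) a (Finset.mem_univ a)
      by_contra! hcon
      simp [oneSubXPerm, hcon] at this
    obtain ⟨a, ha⟩ : ∃ a, σ a ≠ a := by
      by_contra! hcon
      exact hσ.1 (Equiv.ext hcon)
    have hstep : ∀ k : ℕ, σ ((c ^ k) a) = c ((c ^ k) a) := by
      intro k
      induction k with
      | zero => simpa using (hor a).resolve_left ha
      | succ k ih =>
        rw [pow_succ', Equiv.Perm.mul_apply]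
        refine (hor _).resolve_left fun h => ?_
        rw [← ih] at h
        have := σ.injective h
        rw [ih] at this
        exact hne _ this
    refine hσ.2 (Equiv.ext fun b => ?_)
    obtain ⟨k, -, rfl⟩ := (hc.2 (Set.mem_univ a) (Set.mem_univ b)).exists_pow_eq'
    exact hstep k

theorem eval_one_cyclePoly_of_isCycleOn [Nonempty ι] (c : Equiv.Perm ι)
    (hc : c.IsCycleOn Set.univ) : (cyclePoly c).eval 1 = Fintype.card ι := by
  rcases subsingleton_or_nontrivial ι with hι | hι
  -- On one point the long cycle is the identity, so the two Leibniz terms would coincide.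
  · have := Fintype.card_le_one_iff_subsingleton.mpr hι
    have h1 : Fintype.card ι = 1 := le_antisymm this Fintype.card_pos
    rw [Subsingleton.elim c 1, cyclePoly_one, h1]
    simp
  have : cyclePoly c = ∑ i ∈ Finset.range (Fintype.card ι), X ^ i := by
    apply mul_left_cancel₀ one_sub_X_ne_zero
    rw [one_sub_X_mul_cyclePoly, det_oneSubXPerm_of_isCycleOn c hc, mul_neg_geom_sum]
  simp [this, eval_finsetSum]

/-- Each adjugate entry is the determinant with a row replaced by some `e_i`. At `X = 1` the
indicator of an orbit avoiding `i` is a kernel vector. -/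
theorem eval_one_cyclePoly_of_not_isCycleOn (c : Equiv.Perm ι) (hc : ¬ c.IsCycleOn Set.univ) :
    (cyclePoly c).eval 1 = 0 := by
  have hx : ∀ j, ∃ x, ¬ c.SameCycle j x := by
    intro j
    by_contra! h
    exact hc ⟨c.bijective.bijOn_univ, fun a _ b _ => ((h a).symm.trans (h b))⟩
  have key : ∀ i j, ((oneSubXPerm c).adjugate i j).eval 1 = 0 := by
    intro i j
    obtain ⟨x, hx⟩ := hx i
    rw [adjugate_apply, ← coe_evalRingHom, RingHom.map_det]
    classical
    let v : ι → ℚ := fun b => if c.SameCycle x b then 1 else 0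
    have hv : ∀ b, v (Equiv.symm c b) = v b := fun b => by
      simp only [v, Equiv.Perm.sameCycle_symm_apply_right]
    refine exists_mulVec_eq_zero_iff.mp ⟨v, ?_, ?_⟩
    · intro h
      have := congrFun h x
      simp [v, Equiv.Perm.SameCycle.refl] at this
    · funext a
      rw [RingHom.mapMatrix_apply]
      by_cases ha : a = j
      · subst ha
        have : v i = 0 := if_neg fun h => hx h.symm
        simp [mulVec, dotProduct, Pi.single_apply, apply_ite (eval (1 : ℚ)), this]
      · have hc : ∀ b, (a = c b) ↔ (c⁻¹ a = b) := fun b => by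
          rw [Equiv.Perm.inv_eq_iff_eq]
        simp [mulVec, dotProduct, ha, oneSubXPerm, sub_mul, hc, apply_ite (eval (1 : ℚ)), hv]
  simp [cyclePoly, eval_finsetSum, key]

end Determinants
end ReflectionFactorization
end

noncomputable section
namespace ReflectionFactorization
open Equiv

/-! ### Long cycles: conjugacy, number, coboundaries -/

section LongCycles

theorem isCycle_of_isCycleOn_univ {ι : Type*} [Nontrivial ι] {c : Perm ι}
    (hc : c.IsCycleOn Set.univ) : c.IsCycle := by
  obtain ⟨a⟩ : Nonempty ι := inferInstance
  exact ⟨a, hc.apply_ne Set.nontrivial_univ (Set.mem_univ a),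
    fun b _ => hc.2 (Set.mem_univ a) (Set.mem_univ b)⟩

variable {ι : Type*} [Fintype ι] [DecidableEq ι]

theorem support_of_isCycleOn_univ [Nontrivial ι] {c : Perm ι}
    (hc : c.IsCycleOn Set.univ) : c.support = Finset.univ := by
  ext a
  simp [hc.apply_ne Set.nontrivial_univ (Set.mem_univ a)]

theorem isConj_of_isCycleOn_univ {c c' : Perm ι} (hc : c.IsCycleOn Set.univ)
    (hc' : c'.IsCycleOn Set.univ) : IsConj c c' := by
  rcases subsingleton_or_nontrivial ι with hι | hι
  · rw [Subsingleton.elim c c']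
  · exact (isCycle_of_isCycleOn_univ hc).isConj (isCycle_of_isCycleOn_univ hc')
      (by rw [support_of_isCycleOn_univ hc, support_of_isCycleOn_univ hc'])

/-- Nontriviality matters: `cycleType` omits fixed points, so on one point it is empty. -/
theorem isCycleOn_univ_iff_cycleType [Nontrivial ι] (c : Perm ι) :
    c.IsCycleOn Set.univ ↔ c.cycleType = {Fintype.card ι} := by
  constructor
  · intro hc
    rw [(isCycle_of_isCycleOn_univ hc).cycleType, support_of_isCycleOn_univ hc, Finset.card_univ]
  · intro h
    have hcyc : c.IsCycle := by
      rw [← Perm.card_cycleType_eq_one, h, Multiset.card_singleton]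
    have hs : c.support = Finset.univ := by
      rw [← Finset.card_eq_iff_eq_univ, ← Perm.sum_cycleType, h, Multiset.sum_singleton]
    have := hcyc.isCycleOn
    rwa [← Perm.coe_support_eq_set_support, hs, Finset.coe_univ] at this

theorem card_isCycleOn_univ [Nonempty ι] :
    Nat.card {c : Perm ι // c.IsCycleOn Set.univ} = (Fintype.card ι - 1).factorial := by
  rcases subsingleton_or_nontrivial ι with hι | hι
  · have h1 : Fintype.card ι = 1 :=
      le_antisymm (Fintype.card_le_one_iff_subsingleton.mpr hι) Fintype.card_pos
    have h2 : (1 : Perm ι).IsCycleOn Set.univ :=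
      ⟨(1 : Perm ι).bijective.bijOn_univ, fun a _ b _ => by
        rw [Subsingleton.elim a b]⟩
    have : Unique {c : Perm ι // c.IsCycleOn Set.univ} :=
      ⟨⟨⟨1, h2⟩⟩, fun a => Subtype.ext (Subsingleton.elim _ _)⟩
    rw [Nat.card_unique, h1]
    rfl
  · have h := Perm.card_of_cycleType_singleton (α := ι) Fintype.one_lt_card le_rfl
    rw [Nat.choose_self, mul_one] at h
    simp_rw [isCycleOn_univ_iff_cycleType]
    rw [← h, Nat.card_eq_fintype_card, Fintype.card_subtype]

omit [DecidableEq ι] in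
-- Take partial products of `w` along the orbit of a base point; total product `1` makes them
-- periodic, hence well defined on points.
theorem exists_coboundary {A : Type*} [CommGroup A] {c : Perm ι} (hc : c.IsCycleOn Set.univ)
    (w : ι → A) (hw : ∏ i, w i = 1) : ∃ v : ι → A, ∀ b, v (c b) = v b * w b := by
  rcases isEmpty_or_nonempty ι with hι | ⟨⟨a⟩⟩
  · exact ⟨w, fun b => isEmptyElim b⟩
  have hc' : c.IsCycleOn (Finset.univ : Finset ι) := by rwa [Finset.coe_univ]
  let f : ℕ → A := fun k => ∏ i ∈ Finset.range k, w ((c ^ i) a)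
  have hperiod : ∏ i ∈ Finset.range (Finset.univ : Finset ι).card, w ((c ^ i) a) = 1 := by
    rw [← hw]
    refine Finset.prod_nbij (fun i => (c ^ i) a) (fun _ _ => Finset.mem_univ _) ?_ ?_ fun _ _ => rfl
    · intro i hi j hj hij
      rw [hc'.pow_apply_eq_pow_apply (Finset.mem_univ a)] at hij
      exact Nat.ModEq.eq_of_lt_of_lt hij (by simpa using hi) (by simpa using hj)
    · intro b _
      obtain ⟨k, hk, rfl⟩ := hc'.exists_pow_eq (Finset.mem_univ a) (Finset.mem_univ b)
      exact ⟨k, by simpa using hk, rfl⟩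
  have hstep : ∀ k, f (k + (Finset.univ : Finset ι).card) = f k := by
    intro k
    simp only [f]
    rw [add_comm, Finset.prod_range_add, hperiod, one_mul]
    refine Finset.prod_congr rfl fun i _ => ?_
    rw [add_comm, pow_add, Perm.mul_apply, (hc'.pow_apply_eq (Finset.mem_univ _)).mpr dvd_rfl]
  have hper : Function.Periodic f (Finset.univ : Finset ι).card := hstep
  have hf : ∀ k l, (c ^ k) a = (c ^ l) a → f k = f l := by
    intro k l h
    rw [hc'.pow_apply_eq_pow_apply (Finset.mem_univ a)] at h
    rw [← hper.map_mod_nat k, ← hper.map_mod_nat l, h]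
  have hex : ∀ b, ∃ k, (c ^ k) a = b := fun b =>
    let ⟨k, _, hk⟩ := hc'.exists_pow_eq (Finset.mem_univ a) (Finset.mem_univ b)
    ⟨k, hk⟩
  choose κ hκ using hex
  refine ⟨fun b => f (κ b), fun b => ?_⟩
  have : f (κ (c b)) = f (κ b + 1) := hf _ _ (by rw [hκ, pow_succ', Perm.mul_apply, hκ])
  simp only [this]
  simp only [f, Finset.prod_range_succ, hκ]

theorem card_prod_eq {A : Type*} [CommGroup A] [Finite A] (n : ℕ) (hn : 0 < n) (a : A) :
    Nat.card {u : Fin n → A // ∏ i, u i = a} = Nat.card A ^ (n - 1) := by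
  obtain ⟨m, rfl⟩ := Nat.exists_eq_succ_of_ne_zero hn.ne'
  have e : {u : Fin (m + 1) → A // ∏ i, u i = a} ≃ (Fin m → A) :=
    { toFun := fun u => Fin.tail u.1
      invFun := fun t => ⟨Fin.cons (a * (∏ i, t i)⁻¹) t, by simp [Fin.prod_univ_succ]⟩
      left_inv := by
        rintro ⟨u, rfl⟩
        ext i
        refine Fin.cases ?_ (fun i => ?_) i
        · simp [Fin.prod_univ_succ, Fin.tail]
        · simp [Fin.tail]
      right_inv := fun t => by simp }
  rw [Nat.card_congr e]
  simp [Nat.card_fun]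

end LongCycles

/-! ### Words in a set of generators -/

section Words

variable {I M : Type*} [Group M]

/-- The product `ρ_m ⋯ ρ_1` of a word. -/
def wordProd (ρ : I → M) {m : ℕ} (t : Fin m → I) : M := (List.ofFn fun i => ρ (t i)).reverse.prod

theorem wordProd_zero (ρ : I → M) (t : Fin 0 → I) : wordProd ρ t = 1 := by simp [wordProd]

theorem wordProd_snoc (ρ : I → M) {m : ℕ} (t : Fin m → I) (x : I) :
    wordProd ρ (Fin.snoc t x : Fin (m + 1) → I) = ρ x * wordProd ρ t := by
  rw [wordProd, wordProd, List.ofFn_succ']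
  simp [Fin.snoc_castSucc, Fin.snoc_last]

theorem wordProd_induction (ρ : I → M) {P : M → Prop} (h1 : P 1)
    (hP : ∀ x g, P g → P (ρ x * g)) {m : ℕ} (t : Fin m → I) : P (wordProd ρ t) := by
  induction m with
  | zero => rwa [wordProd_zero]
  | succ m ih =>
    rw [← Fin.snoc_init_self t, wordProd_snoc]
    exact hP _ _ (ih _)

/-- Each new letter multiplies the sum by the eigenvalue. The invariant `P` confines the
eigenfunction equation to elements that words can reach. -/
theorem sum_wordProd [Fintype I] (ρ : I → M) {P : M → Prop} (h1 : P 1)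
    (hP : ∀ x g, P g → P (ρ x * g)) (Φ : M → ℚ) (l : ℚ)
    (hΦ : ∀ g, P g → ∑ x, Φ (ρ x * g) = l * Φ g) (m : ℕ) :
    ∑ t : Fin m → I, Φ (wordProd ρ t) = l ^ m * Φ 1 := by
  induction m with
  | zero => simp [wordProd_zero]
  | succ m ih =>
    rw [← (Fin.snocEquiv fun _ => I).sum_comp, Fintype.sum_prod_type_right]
    simp only [Fin.snocEquiv, Equiv.coe_fn_mk, wordProd_snoc]
    rw [Finset.sum_congr rfl fun t _ => hΦ _ (wordProd_induction ρ h1 hP t), ← Finset.mul_sum, ih]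
    ring

theorem wordProd_map {N : Type*} [Group N] (f : M →* N) (ρ : I → M) {m : ℕ} (t : Fin m → I) :
    wordProd (fun x => f (ρ x)) t = f (wordProd ρ t) := by
  simp [wordProd, map_list_prod, List.map_reverse, List.map_ofFn, Function.comp_def]

/-- Conjugation by `h` permutes the letters, hence acts bijectively on words. -/
theorem card_wordProd_conj (ρ : I → M) [Finite I] (hρ : Function.Injective ρ) (h : M)
    (hconj : ∀ x, ∃ y, ρ y = h * ρ x * h⁻¹) (g : M) (m : ℕ) :
    Nat.card {t : Fin m → I // wordProd ρ t = h * g * h⁻¹} =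
      Nat.card {t : Fin m → I // wordProd ρ t = g} := by
  choose e he using hconj
  have hinj : Function.Injective e := fun x y hxy => hρ (by
    have h1 := he x
    rw [hxy, he y] at h1
    simpa using h1.symm)
  have hbij : Function.Bijective e := Finite.injective_iff_bijective.mp hinj
  have hw : ∀ t : Fin m → I, wordProd ρ (fun i => e (t i)) = h * wordProd ρ t * h⁻¹ := by
    intro t
    have := wordProd_map (MulAut.conj h).toMonoidHom ρ t
    simp only [MulEquiv.toMonoidHom_eq_coe, MonoidHom.coe_coe, MulAut.conj_apply, ← he] at this
    exact this
  refine (Nat.card_congr (Equiv.subtypeEquiv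
    (Equiv.arrowCongr (Equiv.refl _) (Equiv.ofBijective e hbij)) fun t => ?_)).symm
  have := hw t
  change _ ↔ wordProd ρ (fun i => e (t i)) = _
  rw [this]
  simp

end Words

end ReflectionFactorization
end

noncomputable section
namespace ReflectionFactorization
open Equiv

/-! ### The generalized symmetric group and its reflections -/

section Monomial

/-- The generalized symmetric group of monomial matrices of size `n` with nonzero entries in `A`;
an element `g` stands for the matrix with the entry `g.left (g.right b)` at `(g.right b, b)`. -/
abbrev Monomial (A : Type*) [CommGroup A] (n : ℕ) :=
  (Fin n → A) ⋊[mulAutArrow (G := Perm (Fin n)) (A := Fin n) (M := A)] Perm (Fin n)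

variable {A : Type*} [CommGroup A] {n : ℕ}

theorem Monomial.mul_left_apply (g h : Monomial A n) (i : Fin n) :
    (g * h).left i = g.left i * h.left (g.right.symm i) := rfl

/-- The product of the nonzero entries. -/
def Monomial.weight : Monomial A n →* A where
  toFun g := ∏ i, g.left i
  map_one' := by simp
  map_mul' g h := by
    simp only [Monomial.mul_left_apply, Finset.prod_mul_distrib]
    congr 1
    exact Equiv.prod_comp g.right.symm h.left

theorem Monomial.weight_apply (g : Monomial A n) : g.weight = ∏ i, g.left i := rfl

/-- A permutation matrix aligns the two cycles; a diagonal matrix then aligns the entries. The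
latter is a coboundary equation along the cycle, solvable because the weights agree. -/
theorem Monomial.exists_conj_eq {g g' : Monomial A n} (hg : g.right.IsCycleOn Set.univ)
    (hg' : g'.right.IsCycleOn Set.univ) (hw : g.weight = g'.weight) :
    ∃ h : Monomial A n, g' = h * g * h⁻¹ := by
  obtain ⟨p, hp⟩ := isConj_iff.mp (isConj_of_isCycleOn_univ hg hg')
  let k : Monomial A n := SemidirectProduct.inr p * g * (SemidirectProduct.inr p)⁻¹
  have hkr : k.right = g'.right := by simp [k, hp]
  have hkw : k.weight = g'.weight := by simp [k, hw]
  suffices h : ∃ v : Fin n → A, g' * SemidirectProduct.inl v = SemidirectProduct.inl v * k by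
    obtain ⟨v, hv⟩ := h
    refine ⟨SemidirectProduct.inl v * SemidirectProduct.inr p, ?_⟩
    rw [mul_inv_rev, eq_comm, ← mul_assoc, mul_inv_eq_iff_eq_mul, hv]
    simp [k, mul_assoc]
  -- The cocycle comes from comparing `g' v` with `v k` at position `g'.right b`.
  obtain ⟨v, hv⟩ := exists_coboundary hg' (fun b => g'.left (g'.right b) * (k.left (g'.right b))⁻¹) (by
    rw [Finset.prod_mul_distrib, Equiv.prod_comp g'.right g'.left,
      Equiv.prod_comp g'.right fun b => (k.left b)⁻¹, Finset.prod_inv_distrib]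
    rw [Monomial.weight_apply, Monomial.weight_apply] at hkw
    rw [hkw, mul_inv_cancel])
  refine ⟨v, ?_⟩
  ext i
  · have := hv (g'.right.symm i)
    simp only [Equiv.apply_symm_apply] at this
    rw [Monomial.mul_left_apply, Monomial.mul_left_apply]
    simp only [SemidirectProduct.left_inl, SemidirectProduct.right_inl]
    change _ = v i * k.left i
    rw [this]
    rw [mul_assoc (v _), inv_mul_cancel_right, mul_comm]
  · simp [hkr]

theorem Monomial.card_class [Finite A] (hn : 0 < n) (a : A) :
    Nat.card {g : Monomial A n // g.right.IsCycleOn Set.univ ∧ g.weight = a} =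
      (n - 1).factorial * Nat.card A ^ (n - 1) := by
  have e : {g : Monomial A n // g.right.IsCycleOn Set.univ ∧ g.weight = a} ≃
      {c : Perm (Fin n) // c.IsCycleOn Set.univ} × {u : Fin n → A // ∏ i, u i = a} :=
    { toFun := fun g => (⟨g.1.right, g.2.1⟩, ⟨g.1.left, g.2.2⟩)
      invFun := fun p => ⟨⟨p.2.1, p.1.1⟩, p.1.2, p.2.2⟩
      left_inv := fun g => rfl
      right_inv := fun p => rfl }
  have : Nonempty (Fin n) := ⟨⟨0, hn⟩⟩
  rw [Nat.card_congr e, Nat.card_prod, card_isCycleOn_univ, card_prod_eq n hn, Fintype.card_fin]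

theorem Monomial.card_eq [Finite A] :
    Nat.card (Monomial A n) = Nat.card A ^ n * n.factorial := by
  rw [SemidirectProduct.card, Nat.card_fun, Nat.card_perm]
  simp

variable (B : Subgroup A)

variable (n) in
/-- Indices of the reflections with entries in `A` and determinants (up to sign) in `B`. -/
abbrev ReflectionIndex :=
  ({p : Fin n × Fin n // p.1 < p.2} × A) ⊕ (Fin n × {b : B // b ≠ 1})

/-- The reflection with a given index. -/
def monomialReflection : ReflectionIndex n B → Monomial A n
  | .inl (p, a) => ⟨Pi.mulSingle p.1.1 a⁻¹ * Pi.mulSingle p.1.2 a, swap p.1.1 p.1.2⟩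
  | .inr (i, b) => ⟨Pi.mulSingle i (b : A), 1⟩

theorem swap_eq_swap_of_lt {i j k l : Fin n} (h1 : i < j) (h2 : k < l)
    (h : swap i j = swap k l) : i = k ∧ j = l := by
  have hs := congrArg Perm.support h
  rw [Perm.support_swap h1.ne, Perm.support_swap h2.ne] at hs
  have hi : i ∈ ({k, l} : Finset (Fin n)) := hs ▸ by simp
  have hj : j ∈ ({k, l} : Finset (Fin n)) := hs ▸ by simp
  simp only [Finset.mem_insert, Finset.mem_singleton] at hi hj
  omega

theorem monomialReflection_injective : Function.Injective (monomialReflection (n := n) B) := by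
  rintro (⟨⟨⟨i, j⟩, hij⟩, a⟩ | ⟨i, b, hb⟩) (⟨⟨⟨k, l⟩, hkl⟩, a'⟩ | ⟨k, b', hb'⟩) h
  · simp only [monomialReflection] at h
    have hl := congrArg SemidirectProduct.left h
    have hr := congrArg SemidirectProduct.right h
    simp only at hij hkl hl hr
    obtain ⟨rfl, rfl⟩ := swap_eq_swap_of_lt hij hkl hr
    have := congrFun hl j
    simp [hij.ne'] at this
    rw [this]
  · have hr := congrArg SemidirectProduct.right h
    exact absurd (swap_eq_one_iff.mp hr) hij.ne
  · have hr := congrArg SemidirectProduct.right h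
    exact absurd (swap_eq_one_iff.mp hr.symm) hkl.ne
  · have hl := congrFun (congrArg SemidirectProduct.left h)
    simp only [monomialReflection] at hl
    have hb1 : (b : A) ≠ 1 := by simpa using hb
    have hik : i = k := by
      by_contra hne
      have := hl i
      simp [hne] at this
      exact hb this
    subst hik
    have := hl i
    simp at this
    simp [this]

theorem weight_monomialReflection_inl (p : {p : Fin n × Fin n // p.1 < p.2}) (a : A) :
    (monomialReflection B (.inl (p, a))).weight = 1 := by
  simp [monomialReflection, Monomial.weight_apply, Finset.prod_mul_distrib]

theorem weight_monomialReflection_inr (i : Fin n) (b : {b : B // b ≠ 1}) :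
    (monomialReflection B (.inr (i, b))).weight = b := by
  simp [monomialReflection, Monomial.weight_apply]

/-- The conjugating element may have weight outside `B`; this is needed because
`Monomial.exists_conj_eq` does not control its weight. -/
theorem exists_monomialReflection_eq_conj (h : Monomial A n) (x : ReflectionIndex n B) :
    ∃ y, monomialReflection B y = h * monomialReflection B x * h⁻¹ := by
  have hswap : ∀ (i j : Fin n) (hij : i ≠ j) (a : A), ∃ y, monomialReflection B y =
      ⟨Pi.mulSingle i a⁻¹ * Pi.mulSingle j a, swap i j⟩ := by
    intro i j hij a
    rcases lt_or_gt_of_ne hij with h | h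
    · exact ⟨.inl (⟨(i, j), h⟩, a), rfl⟩
    -- Reversing the two positions inverts the label.
    · refine ⟨.inl (⟨(j, i), h⟩, a⁻¹), ?_⟩
      simp only [monomialReflection, inv_inv, swap_comm j i]
      rw [mul_comm]
  rcases x with ⟨⟨⟨i, j⟩, hij⟩, a⟩ | ⟨i, b, hb⟩
  · obtain ⟨y, hy⟩ := hswap (h.right i) (h.right j) (by simpa using hij.ne)
      (h.left (h.right j) * a * (h.left (h.right i))⁻¹)
    refine ⟨y, ?_⟩
    rw [hy, eq_mul_inv_iff_mul_eq]
    ext k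
    · obtain ⟨l, rfl⟩ := h.right.surjective k
      simp only [Monomial.mul_left_apply, monomialReflection, Equiv.symm_apply_apply,
        Pi.mul_apply, Pi.mulSingle_apply, EmbeddingLike.apply_eq_iff_eq, Equiv.symm_swap]
      simp only at hij
      rcases eq_or_ne l i with rfl | hi
      · simp [hij.ne]
        group
      · rcases eq_or_ne l j with rfl | hj
        · simp [hij.ne']
        · rw [swap_apply_of_ne_of_ne (by simpa using hi) (by simpa using hj)]
          simp [hi, hj]
    · simp [monomialReflection, swap_apply_apply]
  · refine ⟨.inr (h.right i, ⟨b, hb⟩), ?_⟩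
    rw [eq_mul_inv_iff_mul_eq]
    ext k
    · obtain ⟨l, rfl⟩ := h.right.surjective k
      simp only [Monomial.mul_left_apply, monomialReflection, Equiv.symm_apply_apply,
        Pi.mulSingle_apply, EmbeddingLike.apply_eq_iff_eq, Perm.one_def, Equiv.refl_symm, Equiv.refl_apply]
      rw [mul_comm]
    · simp [monomialReflection]

end Monomial

end ReflectionFactorization
end

noncomputable section
namespace ReflectionFactorization
open Equiv Polynomial

/-! ### Coefficients as eigenfunctions -/

section Coefficients

theorem sum_ne_eq_two_mul_sum_lt {n : ℕ} (F : Fin n → Fin n → ℚ) (hF : ∀ i j, F i j = F j i) :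
    ∑ p : Fin n × Fin n with p.1 ≠ p.2, F p.1 p.2 =
      2 * ∑ p : {p : Fin n × Fin n // p.1 < p.2}, F p.1.1 p.1.2 := by
  have hlt : ∑ p : {p : Fin n × Fin n // p.1 < p.2}, F p.1.1 p.1.2 =
      ∑ p : Fin n × Fin n with p.1 < p.2, F p.1 p.2 :=
    (Finset.sum_subtype _ (by simp) fun p : Fin n × Fin n => F p.1 p.2).symm
  have hgt : ∑ p : Fin n × Fin n with p.2 < p.1, F p.1 p.2 =
      ∑ p : Fin n × Fin n with p.1 < p.2, F p.1 p.2 :=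
    Finset.sum_equiv (Equiv.prodComm _ _) (by simp) fun p _ => hF _ _
  have hne : ({p | p.1 ≠ p.2} : Finset (Fin n × Fin n)) =
      ({p | p.1 < p.2} : Finset (Fin n × Fin n)) ∪ ({p | p.2 < p.1} : Finset (Fin n × Fin n)) := by
    ext p
    simp [lt_or_lt_iff_ne]
  rw [hne, Finset.sum_union, hgt, ← hlt, two_mul]
  rw [Finset.disjoint_filter]
  intro p _ h1
  exact h1.not_gt

theorem card_lt_pairs (n : ℕ) :
    (Nat.card {p : Fin n × Fin n // p.1 < p.2} : ℚ) = n * (n - 1) / 2 := by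
  have h := sum_ne_eq_two_mul_sum_lt (n := n) (fun _ _ => 1) fun _ _ => rfl
  have hoff : ({p | p.1 ≠ p.2} : Finset (Fin n × Fin n)) = Finset.univ.offDiag := by
    ext p
    simp
  rw [hoff, Finset.sum_const, Finset.sum_const, Finset.offDiag_card] at h
  simp only [Finset.card_univ, Fintype.card_fin, nsmul_eq_mul, mul_one] at h
  rw [Nat.cast_sub (Nat.le_mul_self n), Nat.cast_mul] at h
  rw [Nat.card_eq_fintype_card]
  linear_combination -h / 2

variable {ι : Type*} [Fintype ι] [DecidableEq ι] [Nonempty ι]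

theorem cyclePoly_one_coeff (k : ℕ) : (cyclePoly (1 : Perm ι)).coeff k =
    (-1) ^ k * (Fintype.card ι - 1).choose k := by
  have : (1 - X : ℚ[X]) = (1 + X : ℚ[X]).comp (C (-1) * X) := by
    simp [sub_eq_add_neg]
  rw [cyclePoly_one, this, ← pow_comp, comp_C_mul_X_coeff, coeff_one_add_X_pow, mul_comm]

theorem eval_one_cyclePoly_eq_sum (c : Perm ι) :
    (cyclePoly c).eval 1 = ∑ k ∈ Finset.range (Fintype.card ι), (cyclePoly c).coeff k := by
  have hdeg : (cyclePoly c).natDegree < Fintype.card ι := by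
    rcases eq_or_ne (cyclePoly c) 0 with h0 | h0
    · simp [h0, Fintype.card_pos]
    have h1 : oneSubXPerm c =
        (X : ℚ[X]) • (Matrix.of fun a b => if a = c b then (-1 : ℚ) else 0).map C +
          (1 : Matrix ι ι ℚ).map C := by
      ext1 a b
      simp only [oneSubXPerm, Matrix.of_apply, Matrix.add_apply, Matrix.smul_apply,
        Matrix.map_apply, Matrix.one_apply, smul_eq_mul]
      split_ifs <;> simp [sub_eq_add_neg, add_comm]
    have h2 := natDegree_det_X_add_C_le (Matrix.of fun a b => if a = c b then (-1 : ℚ) else 0)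
      (1 : Matrix ι ι ℚ)
    have h3 : (1 - X : ℚ[X]).natDegree = 1 := by
      rw [← neg_sub, natDegree_neg, ← C_1, natDegree_X_sub_C]
    rw [← h1, ← one_sub_X_mul_cyclePoly, natDegree_mul one_sub_X_ne_zero h0, h3] at h2
    omega
  rw [eval_eq_sum_range' hdeg]
  simp

/-- The eigenvalue is the content sum of the hook `(n - k, 1^k)`. -/
theorem sum_cyclePoly_coeff_swap_mul (c : Perm (Fin n)) [NeZero n] (k : ℕ) :
    ∑ p : {p : Fin n × Fin n // p.1 < p.2}, (cyclePoly (swap p.1.1 p.1.2 * c)).coeff k =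
      (n : ℚ) * (n - 1 - 2 * k) / 2 * (cyclePoly c).coeff k := by
  have h := congrArg (fun q => q.coeff k) (sum_cyclePoly_swap_mul c)
  have hX : (X * derivative (cyclePoly c)).coeff k = k * (cyclePoly c).coeff k := by
    cases k with
    | zero => simp
    | succ k => rw [coeff_X_mul, coeff_derivative]; push_cast; ring
  have hR : ((Fintype.card (Fin n) * (Fintype.card (Fin n) - 1) : ℚ[X]) * cyclePoly c
        - 2 * (Fintype.card (Fin n) : ℚ[X]) * X * derivative (cyclePoly c)) =
      C (n * (n - 1) : ℚ) * cyclePoly c - C (2 * n : ℚ) * (X * derivative (cyclePoly c)) := by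
    simp only [Fintype.card_fin, map_mul, map_sub, map_natCast, C_1]
    rw [show (C 2 : ℚ[X]) = 2 from rfl]
    ring
  simp only [hR, coeff_sub, coeff_C_mul, hX, finsetSum_coeff] at h
  rw [sum_ne_eq_two_mul_sum_lt (fun i j => (cyclePoly (swap i j * c)).coeff k)
    fun i j => by rw [swap_comm]] at h
  linear_combination h / 2

end Coefficients

/-! ### Counting factorizations by eigenfunctions -/

section Counting

variable {A : Type*} [CommGroup A] {n : ℕ} (B : Subgroup A)

open scoped Classical in
-- The label of a transposition-type reflection affects neither weight nor permutation, giving the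
-- factor `|A|`; the position of a diagonal one affects neither, giving `n`.
theorem sum_monomialReflection_mul [Fintype A] (f : A → Perm (Fin n) → ℚ) (g : Monomial A n) :
    ∑ x, f (monomialReflection B x * g).weight (monomialReflection B x * g).right =
      Nat.card A * ∑ p : {p : Fin n × Fin n // p.1 < p.2}, f g.weight (swap p.1.1 p.1.2 * g.right) +
      n * ∑ b : {b : B // b ≠ 1}, f (b * g.weight) g.right := by
  rw [Fintype.sum_sum_type, Fintype.sum_prod_type, Fintype.sum_prod_type]
  simp only [map_mul, weight_monomialReflection_inl, weight_monomialReflection_inr, one_mul,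
    SemidirectProduct.mul_right]
  simp [monomialReflection, Finset.mul_sum]

/-- The number of factorizations of `ω` into `m` reflections. -/
def numFactorizations (ω : Monomial A n) (m : ℕ) : ℕ :=
  Nat.card {t : Fin m → ReflectionIndex n B // wordProd (monomialReflection B) t = ω}

open scoped Classical in
theorem sum_coeff_wordProd [Fintype A] [NeZero n] (h : A → ℚ) (ν : ℚ)
    (hν : ∀ w ∈ B, ∑ b : {b : B // b ≠ 1}, h (b * w) = ν * h w) (k m : ℕ) :
    ∑ t : Fin m → ReflectionIndex n B, h (wordProd (monomialReflection B) t).weight *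
        (cyclePoly (wordProd (monomialReflection B) t).right).coeff k =
      ((Nat.card A : ℚ) * (n * (n - 1 - 2 * k) / 2) + n * ν) ^ m *
        (h 1 * ((-1) ^ k * (n - 1).choose k)) := by
  rw [sum_wordProd (monomialReflection B) (P := fun g => g.weight ∈ B) (by simp) ?_
    (fun g => h g.weight * (cyclePoly g.right).coeff k)
     ((Nat.card A : ℚ) * (n * (n - 1 - 2 * k) / 2) + n * ν)]
  · simp [cyclePoly_one_coeff]
  · intro g hg
    rw [sum_monomialReflection_mul B (fun w c => h w * (cyclePoly c).coeff k), ← Finset.mul_sum,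
      ← Finset.sum_mul, sum_cyclePoly_coeff_swap_mul, hν _ hg]
    ring
  · rintro (⟨p, a⟩ | ⟨i, b⟩) g hg
    · rwa [map_mul, weight_monomialReflection_inl, one_mul]
    · rw [map_mul, weight_monomialReflection_inr]
      exact mul_mem b.1.2 hg

/-- All elements of the conjugacy class of `ω` have equally many factorizations, and the left factor
is the size of the class. -/
theorem card_mul_numFactorizations [Finite A] (hn : 0 < n) {ω : Monomial A n}
    (hω : ω.right.IsCycleOn Set.univ) (m : ℕ) :
    (n - 1).factorial * Nat.card A ^ (n - 1) * numFactorizations B ω m =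
      Nat.card {t : Fin m → ReflectionIndex n B //
        (wordProd (monomialReflection B) t).right.IsCycleOn Set.univ ∧
        (wordProd (monomialReflection B) t).weight = ω.weight} := by
  rw [← Monomial.card_class hn ω.weight]
  let K := {g : Monomial A n // g.right.IsCycleOn Set.univ ∧ g.weight = ω.weight}
  have : Finite (Monomial A n) := Finite.of_equiv _ SemidirectProduct.equivProd.symm
  have e : {t : Fin m → ReflectionIndex n B //
        (wordProd (monomialReflection B) t).right.IsCycleOn Set.univ ∧
        (wordProd (monomialReflection B) t).weight = ω.weight} ≃
      Σ g : K, {t : Fin m → ReflectionIndex n B // wordProd (monomialReflection B) t = g.1} :=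
    { toFun := fun t => ⟨⟨_, t.2⟩, ⟨t.1, rfl⟩⟩
      invFun := fun p => ⟨p.2.1, by rw [p.2.2]; exact p.1.2⟩
      left_inv := fun t => rfl
      right_inv := by
        rintro ⟨⟨g, hg⟩, ⟨t, ht⟩⟩
        obtain rfl : wordProd (monomialReflection B) t = g := ht
        rfl }
  have hK : ∀ g : K, Nat.card {t : Fin m → ReflectionIndex n B //
      wordProd (monomialReflection B) t = g.1} = numFactorizations B ω m := by
    rintro ⟨g, hg, hw⟩
    obtain ⟨h, rfl⟩ := Monomial.exists_conj_eq hω hg hw.symm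
    exact card_wordProd_conj _ (monomialReflection_injective B) h
      (exists_monomialReflection_eq_conj B h) ω m
  have := Fintype.ofFinite K
  rw [Nat.card_congr e, Nat.card_sigma, Finset.sum_congr rfl fun g _ => hK g]
  simp [K]

open scoped Classical in
theorem sum_ne_one [Fintype B] (F : B → ℚ) : ∑ b : {b : B // b ≠ 1}, F b = ∑ b, F b - F 1 := by
  rw [← Finset.sum_subtype ({b | b ≠ 1} : Finset B) (by simp) F, Finset.filter_ne',
    Finset.sum_erase_eq_sub (Finset.mem_univ _)]

open scoped Classical in
theorem numFactorizations_eq [Finite A] (hn : 0 < n) {ω : Monomial A n}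
    (hω : ω.right.IsCycleOn Set.univ) (hB : ω.weight ∈ B) (m : ℕ) :
    (Nat.card B * n.factorial * Nat.card A ^ (n - 1) : ℚ) * numFactorizations B ω m =
      ∑ k ∈ Finset.range n, (-1) ^ k * (n - 1).choose k *
        (((Nat.card A : ℚ) * (n * (n - 1 - 2 * k) / 2) + n * (Nat.card B - 1)) ^ m +
          (Nat.card B * (if ω.weight = 1 then 1 else 0) - 1) *
          ((Nat.card A : ℚ) * (n * (n - 1 - 2 * k) / 2) - n) ^ m) := by
  have : NeZero n := ⟨hn.ne'⟩
  have := Fintype.ofFinite A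
  have hcard : Fintype.card {b : B // b ≠ 1} = (Nat.card B : ℚ) - 1 := by
    have := sum_ne_one B fun _ => (1 : ℚ)
    simpa only [Finset.sum_const, Finset.card_univ, nsmul_eq_mul, mul_one,
      Nat.card_eq_fintype_card] using this
  have h1 := fun k => sum_coeff_wordProd (n := n) B (fun _ => 1) (Nat.card B - 1)
    (fun w hw => by rw [Finset.sum_const, Finset.card_univ, nsmul_eq_mul, hcard]) k m
  -- This function sums to zero over `B`, so its nontrivial translates sum to minus itself. Added to
  -- the constant `1` it gives `|B|` times the indicator of the weight of `ω`.
  have h2 := fun k => sum_coeff_wordProd (n := n) B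
    (fun w => Nat.card B * (if w = ω.weight then 1 else 0) - 1) (-1) (fun w hw => by
      have hsum : ∑ b : B, (if (b : A) * w = ω.weight then (1 : ℚ) else 0) = 1 := by
        have : ∀ b : B, (b : A) * w = ω.weight ↔ b = ⟨ω.weight * w⁻¹, mul_mem hB (inv_mem hw)⟩ := by
          intro b
          rw [Subtype.ext_iff, eq_mul_inv_iff_mul_eq]
        simp [this]
      rw [Finset.sum_sub_distrib, ← Finset.mul_sum, Finset.sum_const, Finset.card_univ,
        nsmul_eq_mul, hcard, sum_ne_one B fun b => if (b : A) * w = ω.weight then (1 : ℚ) else 0,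
        hsum]
      simp only [OneMemClass.coe_one, one_mul]
      ring) k m
  have hfact : (n.factorial : ℚ) = n * (n - 1).factorial := by
    rw [← Nat.mul_factorial_pred hn.ne', Nat.cast_mul]
  have hC := congrArg (Nat.cast (R := ℚ)) (card_mul_numFactorizations B hn hω m)
  push_cast at hC
  have hcount : (n : ℚ) * (Nat.card {t : Fin m → ReflectionIndex n B //
        (wordProd (monomialReflection B) t).right.IsCycleOn Set.univ ∧
        (wordProd (monomialReflection B) t).weight = ω.weight} : ℚ) =
      ∑ t : Fin m → ReflectionIndex n B, ∑ k ∈ Finset.range n,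
        (if (wordProd (monomialReflection B) t).weight = ω.weight then 1 else 0) *
        (cyclePoly (wordProd (monomialReflection B) t).right).coeff k := by
    rw [Nat.card_eq_fintype_card, Fintype.card_subtype, Finset.card_filter, Nat.cast_sum,
      Finset.mul_sum]
    refine Finset.sum_congr rfl fun t _ => ?_
    rw [← Finset.mul_sum]
    have h := eval_one_cyclePoly_eq_sum (wordProd (monomialReflection B) t).right
    rw [Fintype.card_fin] at h
    rw [← h]
    by_cases hc : (wordProd (monomialReflection B) t).right.IsCycleOn Set.univ
    · rw [eval_one_cyclePoly_of_isCycleOn _ hc]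
      simp [hc]
    · rw [eval_one_cyclePoly_of_not_isCycleOn _ hc]
      simp [hc]
  calc _ = (Nat.card B : ℚ) * ((n : ℚ) * (Nat.card {t : Fin m → ReflectionIndex n B //
        (wordProd (monomialReflection B) t).right.IsCycleOn Set.univ ∧
        (wordProd (monomialReflection B) t).weight = ω.weight} : ℚ)) := by
        rw [hfact, ← hC]; ring
    _ = _ := by
        rw [hcount, Finset.sum_comm, Finset.mul_sum]
        refine Finset.sum_congr rfl fun k _ => ?_
        have h3 := congrArg₂ (· + ·) (h1 k) (h2 k)
        simp only [← Finset.sum_add_distrib] at h3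
        rw [Finset.mul_sum]
        have h4 : ∀ w e : ℚ, 1 * e + (Nat.card B * w - 1) * e = Nat.card B * (w * e) := by
          intros; ring
        simp only [h4] at h3
        rw [h3, eq_comm (a := (1 : A))]
        ring

end Counting
end ReflectionFactorization
end

noncomputable section
namespace ReflectionFactorization
open Equiv

/-! ### Exponential generating series -/

section Series

theorem coeff_expSeries (a : ℚ) (m : ℕ) :
    PowerSeries.coeff m (expSeries a) = a ^ m / (m.factorial : ℚ) := by
  simp [expSeries, PowerSeries.coeff_exp, div_eq_mul_inv]

theorem expSeries_add (a b : ℚ) : expSeries (a + b) = expSeries a * expSeries b :=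
  (PowerSeries.exp_mul_exp_eq_exp_add a b).symm

theorem expSeries_pow (a : ℚ) (k : ℕ) : expSeries a ^ k = expSeries (k * a) := by
  induction k with
  | zero => simp [expSeries]
  | succ k ih => rw [pow_succ, ih, ← expSeries_add]; push_cast; ring_nf

theorem rescale_expSeries (a b : ℚ) : PowerSeries.rescale a (expSeries b) = expSeries (a * b) := by
  ext m
  rw [PowerSeries.coeff_rescale, coeff_expSeries, coeff_expSeries, mul_pow, mul_div_assoc]

/-- The exponents in the binomial expansion are exactly the eigenvalues of the transposition part.
-/
theorem expSeries_sub_pow (a : ℚ) {n : ℕ} (hn : 0 < n) :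
    (expSeries (a * n / 2) - expSeries (-(a * n / 2))) ^ (n - 1) =
      ∑ k ∈ Finset.range n, PowerSeries.C ((-1) ^ k * (n - 1).choose k : ℚ) *
        expSeries (a * (n * (n - 1 - 2 * k) / 2)) := by
  rw [sub_eq_add_neg, add_comm, add_pow, Nat.sub_add_cancel hn]
  refine Finset.sum_congr rfl fun k hk => ?_
  have hk' : k ≤ n - 1 := Nat.le_sub_one_of_lt (Finset.mem_range.mp hk)
  rw [neg_pow, expSeries_pow, expSeries_pow, mul_assoc ((-1) ^ k), ← expSeries_add,
    Nat.cast_sub hk', Nat.cast_sub hn]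
  simp only [map_mul, map_pow, map_neg, map_one, map_natCast]
  rw [show (k : ℚ) * -(a * n / 2) + ((n : ℚ) - (1 : ℕ) - k) * (a * n / 2) =
    a * (n * (n - 1 - 2 * k) / 2) by push_cast; ring]
  ring

open scoped Classical in
theorem mk_numFactorizations_eq {A : Type*} [CommGroup A] [Finite A] {n : ℕ} (B : Subgroup A)
    (hn : 0 < n) {ω : Monomial A n} (hω : ω.right.IsCycleOn Set.univ) (hB : ω.weight ∈ B) :
    PowerSeries.mk (fun m => (numFactorizations B ω m : ℚ) / (m.factorial : ℚ)) =
      PowerSeries.C (1 / ((Nat.card B : ℚ) * n.factorial * (Nat.card A : ℚ) ^ (n - 1))) *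
        (expSeries ((n : ℚ) * (Nat.card B - 1)) +
          PowerSeries.C ((Nat.card B : ℚ) * (if ω.weight = 1 then 1 else 0) - 1) * expSeries (-n)) *
        (expSeries ((Nat.card A : ℚ) * n / 2) - expSeries (-((Nat.card A : ℚ) * n / 2))) ^ (n - 1) := by
  ext m
  have h := numFactorizations_eq B hn hω hB m
  have hc : ((Nat.card B : ℚ) * n.factorial * (Nat.card A : ℚ) ^ (n - 1)) ≠ 0 := by
    have h1 : Nat.card B ≠ 0 := Nat.card_pos.ne'
    have h2 : Nat.card A ≠ 0 := Nat.card_pos.ne'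
    have h3 := n.factorial_ne_zero
    positivity
  have hm : (m.factorial : ℚ) ≠ 0 := by exact_mod_cast m.factorial_ne_zero
  rw [PowerSeries.coeff_mk, mul_assoc, PowerSeries.coeff_C_mul, expSeries_sub_pow _ hn,
    Finset.mul_sum, map_sum]
  have hterm : ∀ k : ℕ, PowerSeries.coeff m ((expSeries ((n : ℚ) * (Nat.card B - 1)) +
          PowerSeries.C ((Nat.card B : ℚ) * (if ω.weight = 1 then 1 else 0) - 1) * expSeries (-n)) *
        (PowerSeries.C ((-1) ^ k * (n - 1).choose k : ℚ) *
        expSeries (Nat.card A * (n * (n - 1 - 2 * k) / 2)))) =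
      ((-1) ^ k * (n - 1).choose k *
        (((Nat.card A : ℚ) * (n * (n - 1 - 2 * k) / 2) + n * (Nat.card B - 1)) ^ m +
          (Nat.card B * (if ω.weight = 1 then 1 else 0) - 1) *
          ((Nat.card A : ℚ) * (n * (n - 1 - 2 * k) / 2) - n) ^ m)) / m.factorial := by
    intro k
    rw [mul_left_comm, PowerSeries.coeff_C_mul, add_mul, mul_assoc (PowerSeries.C _),
      ← expSeries_add, ← expSeries_add, map_add, PowerSeries.coeff_C_mul, coeff_expSeries,
      coeff_expSeries, add_comm (n * _ : ℚ), neg_add_eq_sub]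
    ring
  rw [Finset.sum_congr rfl fun k _ => hterm k, ← Finset.sum_div, ← h,
    one_div, mul_div_assoc, inv_mul_cancel_left₀ hc]

end Series
end ReflectionFactorization
end

noncomputable section
namespace ReflectionFactorization
open Equiv

/-! ### Realization inside `GL_n(ℂ)` -/

section ComplexGroup

variable {r s n : ℕ}

/-- The monomial matrix represented by an element of the generalized symmetric group. -/
def toMonomialMatrix (r n : ℕ) : Monomial (rootsOfUnity r ℂ) n →* Matrix (Fin n) (Fin n) ℂ where
  toFun g := Matrix.of fun a b => if a = g.right b then ((g.left a : ℂˣ) : ℂ) else 0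
  map_one' := by
    ext a b
    rcases eq_or_ne a b with rfl | h
    · simp
    · simp [h]
  map_mul' g h := by
    ext a b
    simp only [Matrix.of_apply, Matrix.mul_apply, SemidirectProduct.mul_right, Perm.mul_apply,
      Monomial.mul_left_apply, mul_ite, mul_zero, ite_mul, zero_mul]
    rw [Finset.sum_ite_eq']
    by_cases hab : a = g.right (h.right b)
    · simp [hab]
    · simp [hab]

/-- The monomial matrix represented by an element of the generalized symmetric group, as an
element of `GL_n(ℂ)`. -/
def toGL (r n : ℕ) : Monomial (rootsOfUnity r ℂ) n →* GL (Fin n) ℂ :=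
  (toMonomialMatrix r n).toHomUnits

theorem toGL_apply (g : Monomial (rootsOfUnity r ℂ) n) (a b : Fin n) :
    (toGL r n g).1 a b = if a = g.right b then ((g.left a : ℂˣ) : ℂ) else 0 := rfl

theorem toGL_apply_eq_zero_iff (g : Monomial (rootsOfUnity r ℂ) n) (a b : Fin n) :
    (toGL r n g).1 a b = 0 ↔ a ≠ g.right b := by
  rw [toGL_apply]
  split_ifs with h <;> simp [h]

theorem toGL_mulVec (g : Monomial (rootsOfUnity r ℂ) n) (v : Fin n → ℂ) (a : Fin n) :
    (toGL r n g).1.mulVec v a = ((g.left a : ℂˣ) : ℂ) * v (g.right.symm a) := by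
  have : ∀ b, a = g.right b ↔ g.right.symm a = b := fun b => by rw [Equiv.symm_apply_eq]
  simp [Matrix.mulVec, dotProduct, toGL_apply, this]

theorem toGL_injective : Function.Injective (toGL r n) := by
  intro g h hgh
  have hentry : ∀ a b, (toGL r n g).1 a b = (toGL r n h).1 a b := fun a b => by rw [hgh]
  have hr : g.right = h.right := by
    ext1 b
    by_contra hne
    have h1 := (toGL_apply_eq_zero_iff h (g.right b) b).mpr hne
    rw [← hentry, toGL_apply_eq_zero_iff] at h1
    exact h1 rfl
  ext a
  · have := hentry a (g.right.symm a)
    simpa [toGL_apply, ← hr] using this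
  · rw [hr]

theorem isCycleOn_of_isLongCycle {g : Monomial (rootsOfUnity r ℂ) n}
    (h : IsLongCycle (piMatrix (toGL r n g))) : g.right.IsCycleOn Set.univ := by
  obtain ⟨c, hc, hM⟩ := h
  convert hc
  ext1 b
  have := congrFun (congrFun hM (g.right b)) b
  simp only [piMatrix, Matrix.of_apply, toGL_apply_eq_zero_iff] at this
  by_contra hne
  simp [hne] at this

theorem phi_toGL (g : Monomial (rootsOfUnity r ℂ) n) :
    phi (toGL r n g) = ((g.weight : rootsOfUnity r ℂ) : ℂˣ) := by
  rw [phi, Monomial.weight_apply, Subgroup.val_finsetProd]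
  refine Finset.prod_congr rfl fun a _ => ?_
  rw [Finset.prod_eq_single (g.right.symm a)]
  · rw [dif_neg (by rw [toGL_apply_eq_zero_iff]; simp)]
    ext
    simp [toGL_apply]
  · intro b _ hb
    rw [dif_pos]
    rw [toGL_apply_eq_zero_iff]
    rintro rfl
    simp at hb
  · simp

theorem zeta_isPrimitiveRoot [NeZero r] : IsPrimitiveRoot (zeta r) r :=
  Complex.isPrimitiveRoot_exp r (NeZero.ne r)

/-- `ζ_r^k` as an element of the group of `r`-th roots of unity. -/
def zetaPow (r : ℕ) [NeZero r] (k : ℕ) : rootsOfUnity r ℂ :=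
  ⟨Units.mk0 (zeta r) (zeta_ne_zero r) ^ k, by
    rw [mem_rootsOfUnity, ← pow_mul, mul_comm, pow_mul]
    have : Units.mk0 (zeta r) (zeta_ne_zero r) ^ r = 1 := by
      ext
      simpa using zeta_isPrimitiveRoot.pow_eq_one
    rw [this, one_pow]⟩

theorem coe_zetaPow [NeZero r] (k : ℕ) : ((zetaPow r k : ℂˣ) : ℂ) = zeta r ^ k := by
  simp [zetaPow]

theorem exists_zetaPow_eq [NeZero r] (a : rootsOfUnity r ℂ) : ∃ k < r, zetaPow r k = a := by
  obtain ⟨k, hk, h⟩ := zeta_isPrimitiveRoot.eq_pow_of_pow_eq_one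
    ((mem_rootsOfUnity' r (a : ℂˣ)).mp a.2)
  exact ⟨k, hk, by ext; rw [coe_zetaPow, h]⟩

/-- The subgroup of `(r/s)`-th roots of unity in the group of `r`-th roots of unity. -/
def quotientRoots (r s : ℕ) : Subgroup (rootsOfUnity r ℂ) :=
  (rootsOfUnity (r / s) ℂ).subgroupOf (rootsOfUnity r ℂ)

theorem card_quotientRoots [NeZero r] (hsr : s ∣ r) : Nat.card (quotientRoots r s) = r / s := by
  have : NeZero (r / s) := ⟨(Nat.div_pos (Nat.le_of_dvd (NeZero.pos r) hsr)
    (Nat.pos_of_dvd_of_pos hsr (NeZero.pos r))).ne'⟩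
  rw [quotientRoots, Nat.card_congr (Subgroup.subgroupOfEquivOfLe
    (rootsOfUnity_le_of_dvd (Nat.div_dvd_of_dvd hsr))).toEquiv, Complex.card_rootsOfUnity]

theorem zetaPow_mem_quotientRoots [NeZero r] (hsr : s ∣ r) (k : ℕ) :
    zetaPow r k ∈ quotientRoots r s ↔ s ∣ k := by
  have hs : 0 < s := Nat.pos_of_dvd_of_pos hsr (NeZero.pos r)
  rw [quotientRoots, Subgroup.mem_subgroupOf, mem_rootsOfUnity', coe_zetaPow, ← pow_mul,
    zeta_isPrimitiveRoot.pow_eq_one_iff_dvd]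
  obtain ⟨d, rfl⟩ := hsr
  have hd : 0 < d := Nat.pos_of_mul_pos_left (NeZero.pos (s * d))
  rw [Nat.mul_div_cancel_left d hs, Nat.mul_dvd_mul_iff_right hd]

theorem zetaPow_eq_one_iff [NeZero r] (k : ℕ) : zetaPow r k = 1 ↔ r ∣ k := by
  rw [← zeta_isPrimitiveRoot.pow_eq_one_iff_dvd, ← coe_zetaPow]
  simp

theorem toGL_monomialReflection_inl [NeZero r] {i j : Fin n} (h : i < j) (k : ℕ) :
    toGL r n (monomialReflection (quotientRoots r s) (.inl (⟨(i, j), h⟩, zetaPow r k))) =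
      sigma r i j h k := by
  ext a b
  rw [toGL_apply]
  have hab : a = swap i j b ↔ b = swap i j a := by
    rw [eq_comm, swap_apply_eq_iff]
  simp only [monomialReflection, sigma, sigmaMatrix, Matrix.of_apply, hab]
  rcases eq_or_ne a i with rfl | hi
  · simp [h.ne, coe_zetaPow]
  · rcases eq_or_ne a j with rfl | hj
    · simp [hi, coe_zetaPow]
    · simp [hi, hj, swap_apply_of_ne_of_ne]

theorem toGL_monomialReflection_inr [NeZero r] (i : Fin n) (k : ℕ) (hk) (h1) :
    toGL r n (monomialReflection (quotientRoots r s) (.inr (i, ⟨⟨zetaPow r k, hk⟩, h1⟩))) =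
      tau r i k := by
  ext a b
  rw [toGL_apply]
  simp only [monomialReflection, tau, tauMatrix, Matrix.diagonal_apply, Perm.one_apply]
  rcases eq_or_ne a i with rfl | hi
  · simp [coe_zetaPow]
  · simp [hi]

theorem reflections_eq_range [NeZero r] (hsr : s ∣ r) : reflections r s n =
    Set.range fun x => toGL r n (monomialReflection (quotientRoots r s) x) := by
  have hs : 0 < s := Nat.pos_of_dvd_of_pos hsr (NeZero.pos r)
  ext ρ
  constructor
  · rintro (⟨i, j, h, k, hk, rfl⟩ | ⟨i, k, hk, hkr, rfl⟩)
    · exact ⟨_, toGL_monomialReflection_inl h k⟩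
    · have hlt : s * k < r := by
        calc s * k < s * (r / s) := Nat.mul_lt_mul_of_pos_left hkr hs
          _ = r := Nat.mul_div_cancel' hsr
      refine ⟨_, toGL_monomialReflection_inr i (s * k)
        ((zetaPow_mem_quotientRoots hsr _).mpr ⟨k, rfl⟩) fun h => ?_⟩
      have := (zetaPow_eq_one_iff (s * k)).mp (congrArg Subtype.val h)
      exact absurd (Nat.le_of_dvd (Nat.mul_pos hs hk) this) hlt.not_ge
  · rintro ⟨⟨⟨⟨i, j⟩, h⟩, a⟩ | ⟨i, ⟨⟨b, hb⟩, hb1⟩⟩, rfl⟩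
    · obtain ⟨k, hk, rfl⟩ := exists_zetaPow_eq a
      exact Or.inl ⟨i, j, h, k, hk, toGL_monomialReflection_inl h k⟩
    · obtain ⟨k, hk, rfl⟩ := exists_zetaPow_eq b
      obtain ⟨l, rfl⟩ := (zetaPow_mem_quotientRoots hsr k).mp hb
      refine Or.inr ⟨i, l, ?_, ?_, toGL_monomialReflection_inr i (s * l) hb hb1⟩
      · rw [Nat.pos_iff_ne_zero]
        rintro rfl
        exact hb1 (Subtype.ext ((zetaPow_eq_one_iff _).mpr (by simp)))
      · rwa [Nat.lt_div_iff_mul_lt' hsr]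

/-- It suffices to check generators, whose weights are `1` or lie in `μ_{r/s}`. -/
theorem exists_toGL_eq_of_mem [NeZero r] (hsr : s ∣ r) {ω : GL (Fin n) ℂ}
    (hω : ω ∈ reflectionGroup r s n) :
    ∃ g : Monomial (rootsOfUnity r ℂ) n, g.weight ∈ quotientRoots r s ∧ toGL r n g = ω := by
  have hle : reflectionGroup r s n ≤
      ((quotientRoots r s).comap Monomial.weight).map (toGL r n) := by
    rw [reflectionGroup, Subgroup.closure_le, reflections_eq_range hsr]
    rintro _ ⟨x, rfl⟩
    refine ⟨_, ?_, rfl⟩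
    rcases x with ⟨p, a⟩ | ⟨i, b⟩
    · simp only [Subgroup.coe_comap, Set.mem_preimage, weight_monomialReflection_inl]
      exact one_mem _
    · simp only [Subgroup.coe_comap, Set.mem_preimage, weight_monomialReflection_inr]
      exact b.1.2
  exact hle hω

theorem factorizationSeries_toGL [NeZero r] (hsr : s ∣ r) (g : Monomial (rootsOfUnity r ℂ) n) :
    factorizationSeries r s (toGL r n g) =
      PowerSeries.mk fun m => (numFactorizations (quotientRoots r s) g m : ℚ) / m.factorial := by
  rw [factorizationSeries]
  congr 1
  funext m
  congr 2
  rw [numFactorizations, ← Nat.card_coe_set_eq]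
  have hinj : Function.Injective fun x =>
      toGL r n (monomialReflection (quotientRoots r s) x) :=
    toGL_injective.comp (monomialReflection_injective _)
  have himage : factorizations r s (toGL r n g) m =
      (fun (t : Fin m → ReflectionIndex n (quotientRoots r s)) i =>
        toGL r n (monomialReflection (quotientRoots r s) (t i))) ''
        {t | wordProd (monomialReflection (quotientRoots r s)) t = g} := by
    ext ρ
    simp only [factorizations, reflections_eq_range hsr, Set.mem_ofPred_eq, Set.mem_image]
    constructor
    · rintro ⟨h1, h2⟩
      choose t ht using h1
      refine ⟨t, ?_, funext ht⟩
      apply toGL_injective (r := r)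
      rw [← wordProd_map, ← h2, wordProd]
      simp only [ht]
    · rintro ⟨t, rfl, rfl⟩
      exact ⟨fun i => ⟨t i, rfl⟩, wordProd_map (toGL r n) _ t⟩
  rw [himage]
  exact Nat.card_image_of_injective (fun t t' h => funext fun i => hinj (congrFun h i)) _

end ComplexGroup
end ReflectionFactorization
end

noncomputable section
namespace ReflectionFactorization
open Equiv

/-! ### Orders, reflections and hyperplanes -/

section Cardinalities

variable {r s n : ℕ}

theorem mem_reflectionGroup_of_toGL_monomialReflection [NeZero r] (hsr : s ∣ r)
    (x : ReflectionIndex n (quotientRoots r s)) :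
    toGL r n (monomialReflection (quotientRoots r s) x) ∈ reflectionGroup r s n := by
  apply Subgroup.subset_closure
  rw [reflections_eq_range hsr]
  exact ⟨x, rfl⟩

theorem ncard_reflections [NeZero r] (hsr : s ∣ r) :
    ((reflections r s n).ncard : ℚ) = n * (n - 1) / 2 * r + n * ((r : ℚ) / s - 1) := by
  have hs : (s : ℚ) ≠ 0 := by
    exact_mod_cast (Nat.pos_of_dvd_of_pos hsr (NeZero.pos r)).ne'
  have hinj : Function.Injective fun x =>
      toGL r n (monomialReflection (quotientRoots r s) x) :=
    toGL_injective.comp (monomialReflection_injective _)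
  have hB : (Nat.card {b : quotientRoots r s // b ≠ 1} : ℚ) = (r : ℚ) / s - 1 := by
    classical
    have := Fintype.ofFinite (quotientRoots r s)
    have h := sum_ne_one (quotientRoots r s) fun _ => (1 : ℚ)
    simp only [Finset.sum_const, Finset.card_univ, nsmul_eq_mul, mul_one,
      ← Nat.card_eq_fintype_card] at h
    rw [h, card_quotientRoots hsr, Nat.cast_div hsr hs]
  rw [reflections_eq_range hsr, ← Nat.card_coe_set_eq, Nat.card_range_of_injective hinj,
    Nat.card_sum, Nat.card_prod, Nat.card_prod, Complex.card_rootsOfUnity]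
  push_cast
  rw [card_lt_pairs, hB, Nat.card_eq_fintype_card, Fintype.card_fin]

/-- A monomial matrix is diagonal times permutation. For `s = 1` every diagonal factor is a product
of `τ`'s, and transpositions are the `σ`'s with label `1`. -/
theorem reflectionGroup_one_eq_range [NeZero r] :
    reflectionGroup r 1 n = (toGL r n).range := by
  apply le_antisymm
  · intro ω hω
    obtain ⟨g, -, rfl⟩ := exists_toGL_eq_of_mem (one_dvd r) hω
    exact ⟨g, rfl⟩
  · rintro _ ⟨g, rfl⟩
    have hl : g.left ∈ ((reflectionGroup r 1 n).comap (toGL r n)).comap SemidirectProduct.inl := by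
      refine Subgroup.pi_mem_of_mulSingle_mem _ fun i => ?_
      by_cases h1 : g.left i = 1
      · rw [h1, Pi.mulSingle_one]
        exact one_mem _
      · have hmem : g.left i ∈ quotientRoots r 1 := by
          obtain ⟨k, -, hk⟩ := exists_zetaPow_eq (g.left i)
          rw [← hk, zetaPow_mem_quotientRoots (one_dvd r)]
          exact one_dvd k
        exact mem_reflectionGroup_of_toGL_monomialReflection (one_dvd r)
          (.inr (i, ⟨⟨g.left i, hmem⟩, fun h => h1 (congrArg Subtype.val h)⟩))
    have hr : ∀ p : Perm (Fin n),
        p ∈ ((reflectionGroup r 1 n).comap (toGL r n)).comap SemidirectProduct.inr := by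
      have hlt : ∀ i j : Fin n, i < j → swap i j ∈
          ((reflectionGroup r 1 n).comap (toGL r n)).comap SemidirectProduct.inr := by
        intro i j hij
        have := mem_reflectionGroup_of_toGL_monomialReflection (one_dvd r)
          (.inl (⟨(i, j), hij⟩, (1 : rootsOfUnity r ℂ)))
        simp only [monomialReflection, inv_one, Pi.mulSingle_one, mul_one] at this
        exact this
      intro p
      refine Perm.swap_induction_on p (one_mem _) fun f i j hij hf => mul_mem ?_ hf
      rcases lt_or_gt_of_ne hij with h | h
      · exact hlt i j h
      · rw [swap_comm]
        exact hlt j i h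
    rw [← SemidirectProduct.inl_left_mul_inr_right g, map_mul]
    exact mul_mem hl (hr g.right)

theorem card_reflectionGroup_one [NeZero r] :
    Nat.card (reflectionGroup r 1 n) = r ^ n * n.factorial := by
  rw [reflectionGroup_one_eq_range, ← Nat.card_congr (MonoidHom.ofInjective
    (toGL_injective (r := r) (n := n))).toEquiv, Monomial.card_eq, Complex.card_rootsOfUnity]

variable (r n) in
/-- The hyperplanes `v_i = a⁻¹ v_j` and `v_i = 0`. -/
def indexedHyperplane :
    ({p : Fin n × Fin n // p.1 < p.2} × rootsOfUnity r ℂ) ⊕ Fin n → Set (Fin n → ℂ)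
  | .inl (p, a) => {v | ((a : ℂˣ) : ℂ) * v p.1.1 = v p.1.2}
  | .inr i => {v | v i = 0}

/-- The standard basis vectors missing from a hyperplane reveal its type and its indices; for `a v_i
= v_j` the member `e_i + a e_j` then reveals `a`. -/
theorem indexedHyperplane_injective : Function.Injective (indexedHyperplane r n) := by
  have hinl : ∀ p (a : rootsOfUnity r ℂ) x,
      Pi.single x 1 ∈ indexedHyperplane r n (.inl (p, a)) ↔ x ≠ p.1.1 ∧ x ≠ p.1.2 := by
    rintro ⟨⟨i, j⟩, hij⟩ a x
    change ((a : ℂˣ) : ℂ) * (Pi.single x 1 : Fin n → ℂ) i = (Pi.single x 1 : Fin n → ℂ) j ↔ _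
    simp only at hij
    rcases eq_or_ne x i with rfl | hi
    · simp [hij.ne]
    · rcases eq_or_ne x j with rfl | hj
      · simp [hi.symm]
      · simp [hi, hj, hi.symm, hj.symm]
  have hinr : ∀ i x, Pi.single x 1 ∈ indexedHyperplane r n (.inr i) ↔ x ≠ i := by
    intro i x
    change (Pi.single x 1 : Fin n → ℂ) i = 0 ↔ _
    rcases eq_or_ne x i with rfl | hi
    · simp
    · simp [hi, hi.symm]
  rintro (⟨p, a⟩ | i) (⟨q, b⟩ | k) h
  · have hx : ∀ x, (x ≠ p.1.1 ∧ x ≠ p.1.2) ↔ (x ≠ q.1.1 ∧ x ≠ q.1.2) := fun x => by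
      rw [← hinl p a, ← hinl q b, h]
    obtain ⟨⟨i, j⟩, hij⟩ := p
    obtain ⟨⟨k, l⟩, hkl⟩ := q
    simp only at hx hij hkl
    have h1 := hx i
    have h2 := hx j
    have h3 := hx k
    have h4 := hx l
    obtain ⟨rfl, rfl⟩ : i = k ∧ j = l := by omega
    have hmem : (Pi.single i 1 + Pi.single j ((a : ℂˣ) : ℂ) : Fin n → ℂ) ∈
        indexedHyperplane r n (.inl (⟨(i, j), hij⟩, a)) := by
      simp [indexedHyperplane, hij.ne, hij.ne']
    rw [h] at hmem
    have hba : b = a := by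
      ext
      simpa [indexedHyperplane, hij.ne, hij.ne'] using hmem
    rw [hba]
  · have hx : ∀ x, (x ≠ p.1.1 ∧ x ≠ p.1.2) ↔ x ≠ k := fun x => by
      rw [← hinl p a, ← hinr k, h]
    have h1 := hx p.1.1
    have h2 := hx p.1.2
    have h3 := p.2
    omega
  · have hx : ∀ x, x ≠ i ↔ (x ≠ q.1.1 ∧ x ≠ q.1.2) := fun x => by
      rw [← hinl q b, ← hinr i, h]
    have h1 := hx q.1.1
    have h2 := hx q.1.2
    have h3 := q.2
    omega
  · have hx : i ≠ i ↔ i ≠ k := by rw [← hinr i, ← hinr k, h]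
    simp only [ne_eq, not_true_eq_false, false_iff, not_not] at hx
    rw [hx]

theorem fixedSpace_monomialReflection_inl (p : {p : Fin n × Fin n // p.1 < p.2})
    (a : rootsOfUnity r ℂ) : {v | (toGL r n (monomialReflection (quotientRoots r s)
      (.inl (p, a)))).1.mulVec v = v} = indexedHyperplane r n (.inl (p, a)) := by
  obtain ⟨⟨i, j⟩, hij⟩ := p
  simp only at hij
  ext v
  change _ = v ↔ ((a : ℂˣ) : ℂ) * v i = v j
  rw [funext_iff]
  simp only [toGL_mulVec, monomialReflection, symm_swap]
  constructor
  · intro h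
    simpa [hij.ne'] using h j
  · intro h x
    rcases eq_or_ne x i with rfl | hi
    · simp [hij.ne, ← h]
    · rcases eq_or_ne x j with rfl | hj
      · simp [hi, h]
      · simp [hi, hj, swap_apply_of_ne_of_ne]

theorem fixedSpace_monomialReflection_inr (i : Fin n) (b : {b : quotientRoots r s // b ≠ 1}) :
    {v | (toGL r n (monomialReflection (quotientRoots r s) (.inr (i, b)))).1.mulVec v = v} =
      indexedHyperplane r n (.inr i) := by
  have hb : (((b : rootsOfUnity r ℂ) : ℂˣ) : ℂ) ≠ 1 := by
    intro h
    apply b.2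
    ext
    exact h
  ext v
  change _ = v ↔ v i = 0
  rw [funext_iff]
  simp only [toGL_mulVec, monomialReflection, Perm.one_def, refl_symm, refl_apply]
  constructor
  · intro h
    have h1 := h i
    rw [Pi.mulSingle_eq_same] at h1
    by_contra h0
    exact hb ((mul_eq_right₀ h0).mp h1)
  · intro h x
    rcases eq_or_ne x i with rfl | hi
    · simp [h]
    · simp [hi]

/-- All diagonal reflections at `i` share the hyperplane `v_i = 0`, which occurs only if `μ_{r/s}`
is nontrivial. -/
theorem ncard_reflectingHyperplanes [NeZero r] (hsr : s ∣ r)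
    (hB : ∃ b : quotientRoots r s, b ≠ 1) :
    ((reflectingHyperplanes r s n).ncard : ℚ) = n * (n - 1) / 2 * r + n := by
  obtain ⟨b, hb⟩ := hB
  have hrange : reflectingHyperplanes r s n = Set.range (indexedHyperplane r n) := by
    ext H
    constructor
    · rintro ⟨ρ, hρ, rfl⟩
      rw [reflections_eq_range hsr] at hρ
      obtain ⟨⟨p, a⟩ | ⟨i, b⟩, rfl⟩ := hρ
      · exact ⟨.inl (p, a), (fixedSpace_monomialReflection_inl p a).symm⟩
      · exact ⟨.inr i, (fixedSpace_monomialReflection_inr i b).symm⟩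
    · rintro ⟨⟨p, a⟩ | i, rfl⟩
      · exact ⟨_, by rw [reflections_eq_range hsr]; exact ⟨.inl (p, a), rfl⟩,
          (fixedSpace_monomialReflection_inl p a).symm⟩
      · exact ⟨_, by rw [reflections_eq_range hsr]; exact ⟨.inr (i, ⟨b, hb⟩), rfl⟩,
          (fixedSpace_monomialReflection_inr i ⟨b, hb⟩).symm⟩
  rw [hrange, ← Nat.card_coe_set_eq, Nat.card_range_of_injective indexedHyperplane_injective,
    Nat.card_sum, Nat.card_prod, Complex.card_rootsOfUnity]
  push_cast
  rw [card_lt_pairs, Nat.card_eq_fintype_card, Fintype.card_fin]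

end Cardinalities

/-! ### Assembly of the formulas -/

theorem factorizationSeries_eq {r s n : ℕ} [NeZero r] (hsr : s ∣ r) (hn : 0 < n)
    {g : Monomial (rootsOfUnity r ℂ) n} (hg : g.right.IsCycleOn Set.univ)
    (hB : g.weight ∈ quotientRoots r s) :
    factorizationSeries r s (toGL r n g) =
      PowerSeries.C (1 / ((r : ℚ) / s * n.factorial * (r : ℚ) ^ (n - 1))) *
        (expSeries ((n : ℚ) * ((r : ℚ) / s - 1)) +
          PowerSeries.C ((r : ℚ) / s * delta (toGL r n g) - 1) * expSeries (-n)) *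
        (expSeries ((r : ℚ) * n / 2) - expSeries (-((r : ℚ) * n / 2))) ^ (n - 1) := by
  have hs : (s : ℚ) ≠ 0 := by
    exact_mod_cast (Nat.pos_of_dvd_of_pos hsr (NeZero.pos r)).ne'
  rw [factorizationSeries_toGL hsr, mk_numFactorizations_eq _ hn hg hB, card_quotientRoots hsr,
    Nat.cast_div hsr hs, Complex.card_rootsOfUnity, delta, phi_toGL]
  simp only [OneMemClass.coe_eq_one]
  congr

theorem exists_toGL_eq_toGLOne {r s n : ℕ} [NeZero r] (hsr : s ∣ r)
    {g : Monomial (rootsOfUnity r ℂ) n} (hB : g.weight ∈ quotientRoots r s) :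
    ∃ g' : Monomial (rootsOfUnity r ℂ) 1, g'.weight = g.weight ∧
      toGL r 1 g' = toGLOne (phi (toGL r n g)) ∧ toGL r 1 g' ∈ reflectionGroup r s 1 := by
  refine ⟨SemidirectProduct.inl (Pi.mulSingle 0 g.weight), ?_, ?_, ?_⟩
  · simp [Monomial.weight_apply]
  · ext a b
    rw [toGL_apply, phi_toGL, Subsingleton.elim a 0, Subsingleton.elim b 0]
    simp [toGLOne]
  · by_cases h1 : g.weight = 1
    · rw [h1, Pi.mulSingle_one, map_one, map_one]
      exact one_mem _
    · exact mem_reflectionGroup_of_toGL_monomialReflection hsr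
        (.inr (0, ⟨⟨g.weight, hB⟩, fun h => h1 (congrArg Subtype.val h)⟩))

/-- Pulling `e^{n(ρ/2 - 1)x}` out of the first factor leaves one more copy of the hyperbolic
difference; spread over the `n` copies, it shifts both exponents by `ρ/2 - 1`. -/
theorem expSeries_sub_mul_pow (ρ n : ℕ) (hn : 0 < n) :
    (expSeries ((n : ℚ) * (ρ - 1)) - expSeries (-n)) *
        (expSeries ((ρ : ℚ) * n / 2) - expSeries (-((ρ : ℚ) * n / 2))) ^ (n - 1) =
      (expSeries (((n : ℚ) * (n - 1) / 2 * ρ + n * (ρ - 1)) / n) -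
        expSeries (-(((n : ℚ) * (n - 1) / 2 * ρ + n) / n))) ^ n := by
  have hn0 : (n : ℚ) ≠ 0 := by positivity
  have h1 : ((n : ℚ) * (n - 1) / 2 * ρ + n * (ρ - 1)) / n = (ρ / 2 - 1) + ρ * n / 2 := by
    field_simp
    ring
  have h2 : -(((n : ℚ) * (n - 1) / 2 * ρ + n) / n) = (ρ / 2 - 1) + -(ρ * n / 2) := by
    field_simp
    ring
  have h3 : (n : ℚ) * (ρ - 1) = n * (ρ / 2 - 1) + ρ * n / 2 := by ring
  have h4 : -(n : ℚ) = n * (ρ / 2 - 1) + -(ρ * n / 2) := by ring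
  rw [h1, h2, h3]
  rw [show expSeries (-(n : ℚ)) = expSeries (n * (ρ / 2 - 1) + -(ρ * n / 2)) by rw [← h4]]
  simp only [expSeries_add, ← mul_sub]
  rw [mul_pow, expSeries_pow, mul_assoc, ← pow_succ', Nat.sub_add_cancel hn]

end ReflectionFactorization
end

open ReflectionFactorization in
theorem corollary3p5 (r s n : ℕ) (hr : 0 < r) (hs : 0 < s) (hsr : s ∣ r) (hn : 0 < n)
    (ω : GL (Fin n) ℂ) (hω : ω ∈ reflectionGroup r s n) (hπ : IsLongCycle (piMatrix ω)) :
    -- the formula for the factorization series of `ω`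
    (factorizationSeries r s ω =
      PowerSeries.C (1 / ((n.factorial : ℚ) * (r : ℚ) ^ (n - 1))) *
        PowerSeries.rescale (n : ℚ) (factorizationSeries r s (toGLOne (phi ω))) *
        (expSeries ((r : ℚ) * n / 2) - expSeries (-((r : ℚ) * n / 2))) ^ (n - 1)) ∧
    -- the factorization series of `φ(ω) ∈ μ_{r/s} = G(r,s,1)`
    (toGLOne (phi ω) ∈ reflectionGroup r s 1 ∧
      factorizationSeries r s (toGLOne (phi ω)) =
        PowerSeries.C (1 / ((r : ℚ) / s)) * (expSeries ((r : ℚ) / s - 1) - expSeries (-1)) +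
          PowerSeries.C (delta ω) * expSeries (-1)) ∧
    -- the Chapuy–Stump formula for `G(r,1,n)`
    (s = 1 → phi ω ≠ 1 →
      factorizationSeries r s ω =
        PowerSeries.C (1 / (Nat.card (reflectionGroup r s n) : ℚ)) *
          (expSeries (((reflections r s n).ncard : ℚ) / n) -
            expSeries (-(((reflectingHyperplanes r s n).ncard : ℚ) / n))) ^ n) := by
  have : NeZero r := ⟨hr.ne'⟩
  have hd : (r : ℚ) / s ≠ 0 := by positivity
  obtain ⟨g, hB, rfl⟩ := exists_toGL_eq_of_mem hsr hω
  have hg := isCycleOn_of_isLongCycle hπ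
  obtain ⟨g', hw, hg', hmem⟩ := exists_toGL_eq_toGLOne hsr hB
  have hδ : delta (toGL r 1 g') = delta (toGL r n g) := by
    rw [delta, delta, phi_toGL, phi_toGL, hw]
  -- Every permutation of one point is a long cycle, so the general formula applies to `φ(ω)` with
  -- `n = 1`.
  have hcyc : g'.right.IsCycleOn Set.univ :=
    ⟨g'.right.bijective.bijOn_univ, fun a _ b _ => by rw [Subsingleton.elim a b]⟩
  have hone := factorizationSeries_eq hsr one_pos hcyc (hw ▸ hB)
  have hone' : factorizationSeries r s (toGL r 1 g') = PowerSeries.C (1 / ((r : ℚ) / s)) *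
      (expSeries ((r : ℚ) / s - 1) +
        PowerSeries.C ((r : ℚ) / s * delta (toGL r n g) - 1) * expSeries (-1)) := by
    rw [hone, hδ]
    simp
  have hall := factorizationSeries_eq hsr hn hg hB
  have hC : ∀ a b : ℚ, PowerSeries.rescale a (PowerSeries.C b) = PowerSeries.C b := by
    intro a b
    ext m
    rw [PowerSeries.coeff_rescale, PowerSeries.coeff_C]
    split_ifs with h <;> simp [h]
  rw [← hg']
  refine ⟨?_, ⟨hmem, ?_⟩, ?_⟩
  · rw [hall, hone', map_mul, map_add, map_mul, hC, hC, rescale_expSeries, rescale_expSeries,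
      mul_neg_one, ← mul_assoc (PowerSeries.C _), ← map_mul, one_div_mul_one_div_rev]
    rw [mul_assoc ((r : ℚ) / s)]
  · rw [hone', show (r : ℚ) / s * delta (toGL r n g) - 1 =
      (r : ℚ) / s * (delta (toGL r n g) - 1 / ((r : ℚ) / s)) by field_simp]
    have hinv : PowerSeries.C (1 / ((r : ℚ) / s)) * PowerSeries.C ((r : ℚ) / s) = 1 := by
      rw [← map_mul, one_div_mul_cancel hd, map_one]
    rw [map_mul, map_sub]
    linear_combination
      (PowerSeries.C (delta (toGL r n g)) - PowerSeries.C (1 / ((r : ℚ) / s))) * expSeries (-1) * hinv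
  · rintro rfl hφ
    have hδ0 : delta (toGL r n g) = 0 := if_neg hφ
    have hw1 : g.weight ≠ 1 := by
      intro h
      rw [phi_toGL, h] at hφ
      exact hφ rfl
    -- The weight of `ω` itself serves as the nontrivial root of unity that makes the coordinate
    -- hyperplanes reflecting.
    rw [hall, card_reflectionGroup_one, ncard_reflections hsr,
      ncard_reflectingHyperplanes hsr ⟨⟨g.weight, hB⟩, fun h => hw1 (congrArg Subtype.val h)⟩,
      hδ0, Nat.cast_one, div_one, ← expSeries_sub_mul_pow r n hn]
    have hpow : (r : ℚ) * n.factorial * r ^ (n - 1) = ((r ^ n * n.factorial : ℕ) : ℚ) := by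
      push_cast
      rw [mul_right_comm, ← pow_succ', Nat.sub_add_cancel hn]
    rw [hpow, mul_zero, zero_sub, map_neg, map_one, neg_one_mul, ← sub_eq_add_neg, mul_assoc]
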